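/- Let $k$ be a field of characteristic zero, $T$ an indeterminate and $G$ a finite group. Let $P(T,Y)\in k[T,Y]=k[T][Y]$ be monic in $Y$ and separable in $Y$ over $k(T)$ (i.e. without repeated roots), let $F$ be its splitting field over $k(T)$, and assume that $\mathrm{Gal}(F/k(T))\cong G$. Then the following two conditions are equivalent. (1) $P(T,Y)$ is a generic polynomial for $G$ over $k$: for every field extension $L/k$ and every Galois extension $E/L$ of group $G$, the field $E$ is the splitting field over $L$ of $P(t_0,Y)$ for some $t_0\in L$. (2) $F/k(T)$ is a generic extension: it is $k$-regular (i.e. $k$ is algebraically closed in $F$) and, for every field extension $L/k$, every Galois extension $E/L$ of group $G$ is the specialized extension $(FL)_{t_0}/L$ of $FL/L(T)$ at some point $t_0\in\mathbb{P}^1(L)$. Here $FL$ is the compositum of $F$ and $L(T)$ inside an algebraic closure of $L(T)$. For a Galois extension $M/L(T)$ and $t_0\in L$, the specialized extension $M_{t_0}/L$ is the residue extension $B/\mathfrak P$, where $B$ is the integral closure of $L[T]$ in $M$ and $\mathfrak P$ is any prime ideal of $B$ above $\langle T-t_0\rangle$ (up to $L$-isomorphism it does not depend on $\mathfrak P$).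 For $t_0=\infty$, one replaces $L[T]$ by $L[1/T]$ and $\langle T-t_0\rangle$ by $\langle 1/T\rangle$. -/

import Mathlib

open scoped Polynomial

universe u v w

noncomputable section

/-! ### Galois extensions of a given group -/

/-- `E/L` is a (finite) Galois extension of group `G`. -/
def IsGaloisOfGroup (G : Type w) [Group G] (L : Type u) (E : Type v) [Field L] [Field E]
    [Algebra L E] : Prop :=
  FiniteDimensional L E ∧ IsGalois L E ∧ Nonempty ((E ≃ₐ[L] E) ≃* G)

/-! ### Specialization of extensions of `K(T)` at points of the projective line

A point of `ℙ¹(K) = K ∪ {∞}` is an element of `OnePoint K`. -/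

section Specialization

variable (K : Type u) [Field K]

/-- The affine coordinate used around the point `t` of `ℙ¹(K)`:
`T` if `t` is finite, and `1/T` if `t = ∞`. -/
def lineCoord : OnePoint K → RatFunc K
  | some _ => RatFunc.X
  | none => RatFunc.X⁻¹

/-- The ring `A`, equal to `K[T]` if `t` is finite and to `K[1/T]` if `t = ∞`,
as a subring of `K(T)`. -/
def lineRing (t : OnePoint K) : Subalgebra K (RatFunc K) :=
  Algebra.adjoin K {lineCoord K t}

/-- The element `T - t` of `K[T]` if `t` is finite, and `1/T` of `K[1/T]` if `t = ∞`. -/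
def lineParam : (t : OnePoint K) → lineRing K t
  | some a => ⟨RatFunc.X - RatFunc.C a,
      sub_mem (Algebra.self_mem_adjoin_singleton K _) (Subalgebra.algebraMap_mem _ a)⟩
  | none => ⟨RatFunc.X⁻¹, Algebra.self_mem_adjoin_singleton K _⟩

/-- The ideal `⟨T - t⟩` of `K[T]` if `t` is finite, and `⟨1/T⟩` of `K[1/T]` if `t = ∞`. -/
def lineIdeal (t : OnePoint K) : Ideal (lineRing K t) :=
  Ideal.span {lineParam K t}

/-- Given an extension `M/K(T)` and `t ∈ ℙ¹(K)`, the extension `E/K` is (isomorphic over `K` to)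
the specialized extension `M_t/K`: the residue extension `B/𝔓` of a prime ideal `𝔓` above
the ideal of the point `t`, where `B` is the integral closure in `M` of `K[T]`
(of `K[1/T]` if `t = ∞`). If `M/K(T)` is Galois, this does not depend on the choice of `𝔓`. -/
def IsSpecialization (M : Type v) [Field M] [Algebra (RatFunc K) M] [Algebra K M]
    [IsScalarTower K (RatFunc K) M] (t : OnePoint K)
    (E : Type w) [Field E] [Algebra K E] : Prop :=
  ∃ 𝔓 : Ideal (integralClosure (lineRing K t) M),
    𝔓.IsPrime ∧ 𝔓.LiesOver (lineIdeal K t) ∧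
      Nonempty (E ≃ₐ[K] (integralClosure (lineRing K t) M ⧸ 𝔓))

end Specialization

/-! ### Base change of an extension `F/k(T)` to `FL/L(T)` -/

section BaseChange

variable (k : Type u) [Field k]

/-- The inclusion `k(T) → L(T)` attached to a field extension `L/k`. -/
def ratFuncIncl (L : Type v) [Field L] [Algebra k L] : RatFunc k →+* RatFunc L :=
  RatFunc.mapRingHom (Polynomial.mapRingHom (algebraMap k L))
    (nonZeroDivisors_le_comap_nonZeroDivisors_of_injective _
      (Polynomial.map_injective _ (algebraMap k L).injective))

/-- The compositum `FL` of `F` and `L(T)` inside an algebraic closure of `L(T)`: the field generated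
over `L(T)` by the images of `F` under its embeddings over `k(T)`.
If `F/k(T)` is Galois, all these embeddings have the same image. -/
def compositum (F : Type v) [Field F] [Algebra (RatFunc k) F]
    (L : Type w) [Field L] [Algebra k L] :
    IntermediateField (RatFunc L) (AlgebraicClosure (RatFunc L)) :=
  IntermediateField.adjoin (RatFunc L)
    {x | ∃ φ : F →+* AlgebraicClosure (RatFunc L),
      φ.comp (algebraMap (RatFunc k) F) =
        (algebraMap (RatFunc L) (AlgebraicClosure (RatFunc L))).comp (ratFuncIncl k L) ∧
      x ∈ Set.range φ}

end BaseChange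

/-! ### Generic extensions and generic polynomials -/

section Generic

variable (k : Type u) [Field k] (G : Type w) [Group G]

/-- `F/k(T)` is a `k`-regular Galois extension of group `G`. -/
def IsRegularGaloisOfGroup (F : Type v) [Field F] [Algebra (RatFunc k) F]
    [Algebra k F] [IsScalarTower k (RatFunc k) F] : Prop :=
  IsGaloisOfGroup G (RatFunc k) F ∧ algebraicClosure k F = ⊥

/-- The extension `F/k(T)` of group `G` is `L`-parametric: every Galois extension `E/L` of
group `G` is the specialization of `FL/L(T)` at some point of `ℙ¹(L)`. -/
def IsParametric (F : Type v) [Field F] [Algebra (RatFunc k) F]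
    (L : Type u) [Field L] [Algebra k L] : Prop :=
  ∀ (E : Type u) [Field E] [Algebra L E], IsGaloisOfGroup G L E →
    ∃ t₀ : OnePoint L, IsSpecialization L (compositum k F L) t₀ E

/-- The extension `F/k(T)` is a generic extension of group `G`: it is a `k`-regular Galois
extension of group `G` which is `L`-parametric for every field extension `L/k`. -/
def IsGenericExtension (F : Type v) [Field F] [Algebra (RatFunc k) F]
    [Algebra k F] [IsScalarTower k (RatFunc k) F] : Prop :=
  IsRegularGaloisOfGroup k G F ∧
    ∀ (L : Type u) [Field L] [Algebra k L], IsParametric k G F L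

/-- The polynomial `P(T,Y) ∈ k[T,Y] = k[T][Y]`, seen as a polynomial in `Y` over `k(T)`. -/
def polyOverRatFunc (P : k[X][X]) : (RatFunc k)[X] :=
  P.map (algebraMap k[X] (RatFunc k))

/-- `P(t₀,Y) ∈ L[Y]`, for a field extension `L/k` and `t₀ ∈ L`. -/
def specializePoly (P : k[X][X]) {L : Type v} [Field L] [Algebra k L] (t₀ : L) : L[X] :=
  P.map (Polynomial.aeval (R := k) t₀).toRingHom

/-- `P(T,Y)` is a (one parameter) generic polynomial of group `G` over `k`: it is monic and
separable in `Y`, its splitting field over `k(T)` has group `G`, and, for every field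
extension `L/k` and every Galois extension `E/L` of group `G`, the field `E` is
the splitting field over `L` of `P(t₀,Y)` for some `t₀ ∈ L`. -/
structure IsGenericPolynomial (P : k[X][X]) : Prop where
  monic : P.Monic
  separable : (polyOverRatFunc k P).Separable
  group : Nonempty ((polyOverRatFunc k P).Gal ≃* G)
  parametrizes : ∀ (L : Type u) [Field L] [Algebra k L] (E : Type u) [Field E] [Algebra L E],
    IsGaloisOfGroup G L E → ∃ t₀ : L, (specializePoly k P t₀).IsSplittingField L E

end Generic

end

/-!
Let `F/k(T)` be the splitting field of `P`, with group `G`. The bridge between generic polynomials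
and generic extensions is the Noether extension `N/N^G`, where `N = k(x_g : g ∈ G)` and `G` permutes
the indeterminates. Both conditions of the theorem are shown to be equivalent to the statement
`ParametrizesNoether`: the extension `N/N^G` is the splitting field of `P(t₀,Y)` for some `t₀` in
`N^G` which is transcendental over `k`.

* This statement implies that `F/k(T)` is regular, since `T ↦ t₀` extends to an embedding of `F` into
  the field of rational functions `N`, in which `k` is algebraically closed
  (`ParametrizesNoether.algebraicClosure_eq_bot`).
* It implies that `P` is generic (`exists_isSplittingField_of_noether`): given a Galois extension
  `E/L` of group `G`, substitute for the `x_g` the conjugates of an element `a` of `E`. This is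
  equivariant, hence maps `t₀` to an element `t` of `L`. For general `a`, the roots of `P(t₀,Y)` remain
  distinct, so that the Galois group of `E/L` acts faithfully on the roots of `P(t,Y)`.
* A generic polynomial yields it, because the roots of `P` specialized at a constant are
  constants, unless `G` is trivial; in the latter case `F = k(T)` and any indeterminate serves as `t₀`.
* A generic extension yields it as follows. Let `N/N^G` be the specialization at `t₀` of `M/N^G(T)`,
  where `M` is the compositum. If `t₀` is transcendental over `k`, then `P(t₀,Y)` is separable
  and the residue extension is its splitting field, by the surjection of the decomposition group
  onto the automorphisms of the residue field (`isSplittingField_residue`). Otherwise `t₀` is a point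
  of `ℙ¹(k)`. As the residue degree is the order of `G`, this point is inert in `M`, and the fibre
  of `F/k(T)` above it embeds into the residue field `N`. So this fibre, an algebra of dimension
  `[F : k(T)]` over `k`, is `k`, and `G` is trivial (`finrank_le_one_of_constant_point`).

Finally, if `E/L` is the splitting field of `P(t₀,Y)`, then it embeds into the residue extension of
`FL/L(T)` at `t₀`. The degree of the latter is at most the order of `G`, so they agree, even when
`P(t₀,Y)` is inseparable (`isSpecialization_of_isSplittingField`).
-/

noncomputable section

/-! ### The Noether extension of a finite group -/

section Noether

variable (k : Type u) [Field k] (H : Type)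

/-- The field `k(x_h : h ∈ H)` of rational functions in indeterminates indexed by `H`. -/
abbrev NoetherField : Type u := FractionRing (MvPolynomial H k)

variable {k H}

/-- The base field is algebraically closed in a field of rational functions. -/
theorem mem_range_of_isAlgebraic_noetherField {x : NoetherField k H} (hx : IsAlgebraic k x) :
    x ∈ (algebraMap k (NoetherField k H)).range := by
  have h1 : IsIntegral (MvPolynomial H k) x := hx.isIntegral.tower_top
  obtain ⟨p, rfl⟩ := IsIntegrallyClosed.isIntegral_iff.mp h1
  -- The inverse of `p` is a polynomial as well, so `p` is a constant.
  rcases eq_or_ne p 0 with rfl | hp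
  · exact ⟨0, by simp⟩
  have h2 : IsIntegral (MvPolynomial H k) (algebraMap _ (NoetherField k H) p)⁻¹ :=
    hx.inv.isIntegral.tower_top
  obtain ⟨q, hq⟩ := IsIntegrallyClosed.isIntegral_iff.mp h2
  have hp' : algebraMap _ (NoetherField k H) p ≠ 0 := by simpa using hp
  have h3 : p * q = 1 := by
    apply IsFractionRing.injective (MvPolynomial H k) (NoetherField k H)
    rw [map_mul, hq, mul_inv_cancel₀ hp', map_one]
  obtain ⟨c, -, rfl⟩ := MvPolynomial.isUnit_iff_eq_C_of_isReduced.mp (IsUnit.of_mul_eq_one q h3)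
  exact ⟨c, by rw [IsScalarTower.algebraMap_apply k (MvPolynomial H k)]; rfl⟩

theorem transcendental_noetherField_X (h : H) :
    Transcendental k (algebraMap (MvPolynomial H k) (NoetherField k H) (MvPolynomial.X h)) :=
  (transcendental_algebraMap_iff (IsFractionRing.injective _ _)).mpr
    (MvPolynomial.transcendental_X k h)

variable (k H) [Group H]

/-- The automorphism `x_g ↦ x_{hg}` of the polynomial ring `k[x_h : h ∈ H]`. -/
def noetherPerm (h : H) : MvPolynomial H k ≃ₐ[k] MvPolynomial H k :=
  MvPolynomial.renameEquiv k (Equiv.mulLeft h)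

/-- The action of `H` on `k(x_h : h ∈ H)` by `h x_g = x_{hg}`. -/
def noetherHom : H →* (NoetherField k H ≃ₐ[k] NoetherField k H) where
  toFun h := IsFractionRing.algEquivOfAlgEquiv (noetherPerm k H h)
  map_one' := by
    refine AlgEquiv.ext fun x => ?_
    obtain ⟨p, q, -, rfl⟩ := IsFractionRing.div_surjective (MvPolynomial H k) x
    simp [noetherPerm, Equiv.Perm.one_def]
  map_mul' g h := by
    refine AlgEquiv.ext fun x => ?_
    obtain ⟨p, q, -, rfl⟩ := IsFractionRing.div_surjective (MvPolynomial H k) x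
    simp [noetherPerm, MvPolynomial.rename_rename]

variable {k H}

@[simp]
theorem noetherHom_algebraMap (h : H) (p : MvPolynomial H k) :
    noetherHom k H h (algebraMap _ _ p) = algebraMap _ _ (noetherPerm k H h p) := by
  simp [noetherHom]

@[simp]
theorem noetherPerm_X (h g : H) :
    noetherPerm k H h (MvPolynomial.X g) = MvPolynomial.X (h * g) := by
  simp [noetherPerm]

variable (k H)

/-- The action `h x_g = x_{hg}` as an action by ring automorphisms. -/
@[reducible]
def noetherAction : MulSemiringAction H (NoetherField k H) :=
  MulSemiringAction.compHom _ (noetherHom k H)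

attribute [local instance] noetherAction

theorem noether_smul_def (h : H) (x : NoetherField k H) : h • x = noetherHom k H h x := rfl

instance noether_smulCommClass : SMulCommClass H k (NoetherField k H) :=
  ⟨fun h c x => by simp [noether_smul_def]⟩

instance noether_faithful : FaithfulSMul H (NoetherField k H) where
  eq_of_smul_eq_smul {g h} H' := by
    have := H' (algebraMap (MvPolynomial H k) _ (MvPolynomial.X 1))
    rw [noether_smul_def, noether_smul_def, noetherHom_algebraMap, noetherHom_algebraMap,
      (IsFractionRing.injective (MvPolynomial H k) (NoetherField k H)).eq_iff,
      noetherPerm_X, noetherPerm_X] at this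
    simpa using MvPolynomial.X_injective (R := k) this

/-- The field of invariants of `k(x_h : h ∈ H)` under `H`. -/
abbrev NoetherFixed : IntermediateField k (NoetherField k H) :=
  FixedPoints.intermediateField H

instance noether_isGaloisGroup [Finite H] :
    IsGaloisGroup H (NoetherFixed k H) (NoetherField k H) :=
  inferInstanceAs (IsGaloisGroup H (FixedPoints.subfield H (NoetherField k H)) (NoetherField k H))

theorem noether_isGaloisOfGroup [Finite H] :
    IsGaloisOfGroup H (NoetherFixed k H) (NoetherField k H) :=
  ⟨IsGaloisGroup.finiteDimensional H _ _, IsGaloisGroup.isGalois H _ _,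
    ⟨(IsGaloisGroup.mulEquivAlgEquiv H (NoetherFixed k H) (NoetherField k H)).symm⟩⟩

end Noether

/-! ### Polynomials with specialized parameter -/

section SpecializedPolynomials

open Polynomial

/-- A split polynomial whose roots are moved by every nontrivial automorphism of a finite Galois
extension has this extension as its splitting field. -/
theorem isSplittingField_of_forall_fix_eq_one {L : Type*} {E : Type*} [Field L] [Field E]
    [Algebra L E] [FiniteDimensional L E] [IsGalois L E] {f : L[X]}
    (hs : (f.map (algebraMap L E)).Splits)
    (hf : ∀ σ : E ≃ₐ[L] E, (∀ r ∈ f.rootSet E, σ r = r) → σ = 1) : f.IsSplittingField L E where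
  splits' := hs
  adjoin_rootSet' := by
    have h1 : (IntermediateField.adjoin L (f.rootSet E)).fixingSubgroup = ⊥ := by
      refine (Subgroup.eq_bot_iff_forall _).mpr fun σ hσ => hf σ fun r hr => ?_
      exact hσ ⟨r, IntermediateField.subset_adjoin L _ hr⟩
    have h2 : IntermediateField.adjoin L (f.rootSet E) = ⊤ := by
      rw [← IsGalois.fixedField_fixingSubgroup (IntermediateField.adjoin L (f.rootSet E)), h1,
        IntermediateField.fixedField_bot]
    rw [← IntermediateField.adjoin_toSubalgebra_of_isAlgebraic, h2, IntermediateField.top_toSubalgebra]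
    exact fun x _ => Algebra.IsAlgebraic.isAlgebraic x

/-- `P(t,Y)` for an element `t` of a `k`-algebra `A`. -/
def specializeAt {k : Type*} [Field k] (P : k[X][X]) {A : Type*} [CommRing A] [Algebra k A]
    (t : A) : A[X] :=
  P.map (aeval (R := k) t).toRingHom

variable {k : Type u} [Field k] (P : k[X][X])

theorem specializePoly_eq {L : Type*} [Field L] [Algebra k L] (t : L) :
    specializePoly k P t = specializeAt P t := rfl

theorem specializeAt_map {A B : Type*} [CommRing A] [CommRing B] [Algebra k A] [Algebra k B]
    (f : A →ₐ[k] B) (t : A) :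
    (specializeAt P t).map f.toRingHom = specializeAt P (f t) := by
  rw [specializeAt, specializeAt, Polynomial.map_map]
  congr 1
  ext x
  · simp
  · simp

theorem specializeAt_map_algebraMap {A B : Type*} [CommRing A] [CommRing B] [Algebra k A]
    [Algebra k B] [Algebra A B] [IsScalarTower k A B] (t : A) :
    (specializeAt P t).map (algebraMap A B) = specializeAt P (algebraMap A B t) :=
  specializeAt_map P (IsScalarTower.toAlgHom k A B) t

variable {P}

theorem specializeAt_monic (hP : P.Monic) {A : Type*} [CommRing A] [Algebra k A] (t : A) :
    (specializeAt P t).Monic :=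
  hP.map _

end SpecializedPolynomials

/-! ### Generic specialization of the Noether extension -/

section NoetherSpecialization

open Polynomial

/-- A nonzero polynomial in indeterminates indexed by the Galois group does not vanish
at the conjugates of a general element. -/
theorem exists_aeval_conjugates_ne_zero {k L E : Type*} [Field k] [Field L] [Field E] [Infinite L]
    [Algebra L E] [Algebra k E] [FiniteDimensional L E] [IsGalois L E] {H : Type*}
    (e : H ≃ (E ≃ₐ[L] E)) {D : MvPolynomial H k} (hD : D ≠ 0) :
    ∃ a : E, MvPolynomial.aeval (fun h => e h a) D ≠ 0 := by
  classical
  let b := IsGalois.normalBasis L E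
  let m : Matrix (E ≃ₐ[L] E) (E ≃ₐ[L] E) E := fun σ τ => σ (b τ)
  -- By independence of automorphisms, the matrix of conjugates of a basis is invertible.
  have hm : IsUnit m := by
    rw [← Matrix.vecMul_injective_iff_isUnit]
    refine (injective_iff_map_eq_zero (Matrix.vecMulLinear m)).mpr fun v hv => ?_
    have hli : LinearIndependent E fun σ : E ≃ₐ[L] E => (σ : E →ₐ[L] E).toLinearMap :=
      (linearIndependent_algHom_toLinearMap L E E).comp
        (fun σ : E ≃ₐ[L] E => (σ : E →ₐ[L] E)) fun σ τ h => by
          ext x; exact DFunLike.congr_fun h x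
    have := Fintype.linearIndependent_iff.mp hli v (b.ext fun τ => by
      have h : Matrix.vecMul v m τ = 0 := congrFun hv τ
      simpa [Matrix.vecMul, dotProduct, m] using h)
    exact funext this
  have hinf : Infinite E := Infinite.of_injective _ (algebraMap L E).injective
  obtain ⟨z, hz⟩ : ∃ z : H → E, MvPolynomial.eval z (D.map (algebraMap k E)) ≠ 0 := by
    by_contra! hall
    refine hD ((MvPolynomial.map_injective _ (algebraMap k E).injective) ?_)
    rw [map_zero]
    exact MvPolynomial.funext fun z => by rw [hall z, map_zero]
  obtain ⟨w, hw⟩ := Matrix.mulVec_surjective_iff_isUnit.mpr hm (fun σ => z (e.symm σ))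
  -- The polynomial `c ↦ D(e h (∑ c_τ b_τ))`.
  let D' : MvPolynomial (E ≃ₐ[L] E) E := MvPolynomial.aeval
    (fun h => ∑ τ, MvPolynomial.C (m (e h) τ) * MvPolynomial.X τ) D
  have hD'eval (c : (E ≃ₐ[L] E) → E) :
      MvPolynomial.eval c D' = MvPolynomial.aeval (fun h => m.mulVec c (e h)) D := by
    change ((MvPolynomial.aeval c).restrictScalars k) D' = _
    rw [← AlgHom.comp_apply]
    congr 1
    ext h
    simp [Matrix.mulVec, dotProduct]
  have hD' : D' ≠ 0 := by
    intro h0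
    apply hz
    have := hD'eval w
    rw [h0, map_zero, hw] at this
    rw [MvPolynomial.eval_map, ← MvPolynomial.aeval_def]
    simpa using this.symm
  by_contra! hall
  refine hD' (MvPolynomial.funext_set (fun _ => Set.range (algebraMap L E))
    (fun _ => Set.infinite_range_of_injective (algebraMap L E).injective) fun c hc => ?_)
  choose d hd using fun τ => hc τ (Set.mem_univ τ)
  rw [map_zero, hD'eval, ← hall (∑ τ, d τ • b τ)]
  congr 2
  funext h
  simp [m, Matrix.mulVec, dotProduct, map_sum, ← hd, Algebra.smul_def, mul_comm]

theorem isUnit_map_powers {R A F : Type*} [CommRing R] [Field A] [FunLike F R A]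
    [RingHomClass F R A] (g : F) {q : R} (hg : g q ≠ 0) (y : Submonoid.powers q) :
    IsUnit (g y) := by
  obtain ⟨_, n, rfl⟩ := y
  simpa using hg.isUnit.pow n

attribute [local instance] noetherAction

variable {k : Type u} [Field k] [CharZero k] {H : Type} [Group H] [Finite H]

/-- If `P(t₀,Y)` is separable with splitting field `k(x_h : h ∈ H)` over the field of invariants,
then `P` parametrizes all extensions of group `H`: specialize the indeterminates `x_h` to the
conjugates of a general element. -/
theorem exists_isSplittingField_of_noether {P : k[X][X]} (hP : P.Monic)
    (t₀ : NoetherFixed k H) (hsep : (specializePoly k P t₀).Separable)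
    (hsplit : (specializePoly k P t₀).IsSplittingField (NoetherFixed k H) (NoetherField k H))
    (L : Type*) [Field L] [Algebra k L] (E : Type*) [Field E] [Algebra L E]
    (hE : IsGaloisOfGroup H L E) :
    ∃ t : L, (specializePoly k P t).IsSplittingField L E := by
  classical
  obtain ⟨hfin, hgal, ⟨e⟩⟩ := hE
  let : Algebra k E := ((algebraMap L E).comp (algebraMap k L)).toAlgebra
  have : IsScalarTower k L E := IsScalarTower.of_algebraMap_eq fun _ => rfl
  have : CharZero L := charZero_of_injective_algebraMap (algebraMap k L).injective
  let R := MvPolynomial H k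
  let K := NoetherField k H
  let t₁ : K := t₀
  let f : K[X] := specializeAt P t₁
  have hf : f = (specializePoly k P t₀).map (algebraMap _ K) :=
    (specializeAt_map_algebraMap P (B := K) t₀).symm
  have hfs : f.Separable := hf ▸ hsep.map
  let Y : Finset K := f.roots.toFinset
  have hfY : f = ∏ y ∈ Y, (X - C y) := by
    conv_lhs => rw [(hf ▸ hsplit.splits' : f.Splits).eq_prod_roots_of_monic (hP.map _)]
    rw [Finset.prod, Multiset.toFinset_val, (nodup_roots hfs).dedup]
  -- A common denominator `q` of `t₀`, the roots, and the inverses of their differences.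
  let Z : Finset K := {t₁} ∪ Y ∪ (Y ×ˢ Y).image fun p => (p.1 - p.2)⁻¹
  obtain ⟨⟨q, hq⟩, hqZ⟩ := IsLocalization.exist_integer_multiples_of_finset (nonZeroDivisors R) Z
  obtain ⟨a, ha⟩ := exists_aeval_conjugates_ne_zero e.symm.toEquiv (nonZeroDivisors.ne_zero hq)
  let ev : R →ₐ[k] E := MvPolynomial.aeval fun h => e.symm h a
  have hevq : ev q ≠ 0 := ha
  have hev (σ : E ≃ₐ[L] E) (p : R) : σ (ev p) = ev (noetherPerm k H (e σ) p) := by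
    have : ((σ : E →ₐ[L] E).restrictScalars k).comp ev
        = ev.comp (noetherPerm k H (e σ) : R →ₐ[k] R) := by
      refine MvPolynomial.algHom_ext fun h => ?_
      change σ (ev (MvPolynomial.X h)) = ev (noetherPerm k H (e σ) (MvPolynomial.X h))
      rw [noetherPerm_X, MvPolynomial.aeval_X, MvPolynomial.aeval_X, map_mul, e.symm_apply_apply]
      rfl
    exact DFunLike.congr_fun this p
  let S := Localization.Away q
  let ι : R →ₐ[k] K := IsScalarTower.toAlgHom k R K
  have hι : Function.Injective ι := IsFractionRing.injective R K
  have hιq : ι q ≠ 0 := (map_ne_zero_iff ι hι).mpr (nonZeroDivisors.ne_zero hq)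
  let j : S →ₐ[k] K := IsLocalization.liftAlgHom (M := Submonoid.powers q) (isUnit_map_powers ι hιq)
  let s : S →ₐ[k] E := IsLocalization.liftAlgHom (M := Submonoid.powers q) (isUnit_map_powers ev hevq)
  have hjR (p : R) : j (algebraMap R S p) = ι p := by simp [j]
  have hsR (p : R) : s (algebraMap R S p) = ev p := by simp [s]
  have hfrac (z : S) : ∃ p r : R, ev r ≠ 0 ∧ z * algebraMap R S r = algebraMap R S p := by
    obtain ⟨p, ⟨_, n, rfl⟩, rfl⟩ := IsLocalization.exists_mk'_eq (Submonoid.powers q) z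
    exact ⟨p, q ^ n, by simpa using pow_ne_zero n hevq, IsLocalization.mk'_spec _ _ _⟩
  have hj : Function.Injective j := by
    refine (injective_iff_map_eq_zero j).mpr fun z hz => ?_
    obtain ⟨p, ⟨_, n, rfl⟩, rfl⟩ := IsLocalization.exists_mk'_eq (Submonoid.powers q) z
    have h1 := congrArg j (IsLocalization.mk'_spec S p (⟨_, n, rfl⟩ : Submonoid.powers q))
    rw [map_mul, hz, zero_mul, hjR] at h1
    rw [hι (h1.symm.trans (map_zero ι).symm), IsLocalization.mk'_zero]
  have hZ (z : K) (hz : z ∈ Z) : ∃ z' : S, j z' = z := by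
    obtain ⟨p, hp⟩ := hqZ z hz
    refine ⟨IsLocalization.mk' S p (⟨q, 1, pow_one q⟩ : Submonoid.powers q), ?_⟩
    have h1 := congrArg j (IsLocalization.mk'_spec S p (⟨q, 1, pow_one q⟩ : Submonoid.powers q))
    rw [map_mul, hjR, hjR] at h1
    refine mul_right_cancel₀ hιq (h1.trans ?_)
    rw [mul_comm]
    exact hp.trans (Algebra.smul_def _ _)
  -- The specialization is equivariant.
  have hequiv (σ : E ≃ₐ[L] E) (z z' : S) (h : noetherHom k H (e σ) (j z) = j z') :
      σ (s z) = s z' := by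
    obtain ⟨p, r, hr, hz⟩ := hfrac z
    obtain ⟨p', r', hr', hz'⟩ := hfrac z'
    have e1 : noetherPerm k H (e σ) p * r' = p' * noetherPerm k H (e σ) r := by
      apply hι
      have h1 := congrArg (fun y => noetherHom k H (e σ) (j y)) hz
      simp only [map_mul, hjR, h] at h1
      have h2 := congrArg j hz'
      rw [map_mul, hjR, hjR] at h2
      have h3 (p : R) : noetherHom k H (e σ) (ι p) = ι (noetherPerm k H (e σ) p) :=
        noetherHom_algebraMap _ _
      rw [h3, h3] at h1
      rw [map_mul, map_mul, ← h1, ← h2]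
      ring
    have e2 := congrArg ev e1
    rw [map_mul, map_mul, ← hev, ← hev] at e2
    have h1 := congrArg s hz
    have h2 := congrArg s hz'
    rw [map_mul, hsR, hsR] at h1 h2
    have hσr : σ (ev r) ≠ 0 := by simpa using hr
    rw [← h1, ← h2, map_mul] at e2
    exact mul_right_cancel₀ (mul_ne_zero hσr hr') (by linear_combination e2)
  obtain ⟨t', ht'⟩ := hZ t₁ (by simp [Z])
  choose! y' hy' using fun y (hy : y ∈ Y) => hZ y (by simp [Z, hy])
  have hSprod : specializeAt P t' = ∏ y ∈ Y, (X - C (y' y)) := by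
    apply Polynomial.map_injective j.toRingHom hj
    rw [specializeAt_map, ht', Polynomial.map_prod]
    refine hfY.trans (Finset.prod_congr rfl fun y hy => ?_)
    simp [hy' y hy]
  have hEprod : specializeAt P (s t') = ∏ y ∈ Y, (X - C (s (y' y))) := by
    rw [← specializeAt_map, hSprod, Polynomial.map_prod]
    simp
  have hdist (y) (hy : y ∈ Y) (z) (hz : z ∈ Y) (h : s (y' y) = s (y' z)) : y = z := by
    by_contra hne
    obtain ⟨w, hw⟩ := hZ (y - z)⁻¹ (by
      refine Finset.mem_union_right _ (Finset.mem_image.mpr ⟨(y, z), ?_, rfl⟩)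
      simp [hy, hz])
    have h1 : (y' y - y' z) * w = 1 := by
      apply hj
      rw [map_mul, map_sub, hy' y hy, hy' z hz, hw, map_one, mul_inv_cancel₀ (sub_ne_zero.mpr hne)]
    have h2 := congrArg s h1
    rw [map_mul, map_sub, h, sub_self, zero_mul, map_one] at h2
    exact zero_ne_one h2
  obtain ⟨t, ht⟩ : s t' ∈ Set.range (algebraMap L E) := by
    rw [IsGalois.mem_range_algebraMap_iff_fixed]
    intro σ
    refine hequiv σ t' t' ?_
    rw [ht']
    exact t₀.2 (e σ)
  have hroot (y) (hy : y ∈ Y) : s (y' y) ∈ (specializePoly k P t).rootSet E := by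
    rw [mem_rootSet', specializePoly_eq, specializeAt_map_algebraMap, ht, aeval_def,
      eval₂_eq_eval_map, specializeAt_map_algebraMap, ht]
    refine ⟨(specializeAt_monic hP _).ne_zero, ?_⟩
    rw [hEprod, eval_prod]
    exact Finset.prod_eq_zero hy (by simp)
  refine ⟨t, isSplittingField_of_forall_fix_eq_one ?_ fun σ hσ => ?_⟩
  · rw [specializePoly_eq, specializeAt_map_algebraMap, ht, hEprod]
    exact Splits.prod fun y _ => Splits.X_sub_C _
  -- An automorphism fixing the specialized roots fixes the roots, as these stay distinct.
  · let τ : K ≃ₐ[NoetherFixed k H] K := IsGaloisGroup.mulEquivAlgEquiv H (NoetherFixed k H) K (e σ)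
    have hτ (x : K) : τ x = noetherHom k H (e σ) x := rfl
    have hmem (y : K) : y ∈ (specializePoly k P t₀).rootSet K ↔ y ∈ Y := by
      rw [rootSet_def, aroots_def, ← hf, Finset.mem_coe, Multiset.mem_toFinset]
    have h1 : (τ : K →ₐ[NoetherFixed k H] K) = AlgHom.id _ _ := by
      refine AlgHom.ext_of_adjoin_eq_top hsplit.adjoin_rootSet' fun y hy => ?_
      have hyY := (hmem y).mp hy
      have hτy : τ y ∈ Y := by
        rw [← hmem, mem_rootSet']
        refine ⟨(mem_rootSet'.mp hy).1, ?_⟩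
        rw [aeval_algHom_apply τ y, (mem_rootSet'.mp hy).2, map_zero]
      have h2 := hequiv σ (y' y) (y' (τ y)) (by rw [hy' y hyY, hy' _ hτy, hτ])
      rw [hσ _ (hroot y hyY)] at h2
      exact (hdist y hyY _ hτy h2).symm
    have h2 : τ = 1 := AlgEquiv.ext fun x => DFunLike.congr_fun h1 x
    exact e.map_eq_one_iff.mp ((MulEquiv.map_eq_one_iff _).mp h2)

end NoetherSpecialization

/-! ### The local coordinate rings of the projective line -/

section LineRing

open Polynomial

variable (K : Type u) [Field K]

/-- The value at a point `t` of `ℙ¹(K)` of the affine coordinate used around `t`. -/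
def lineValue : OnePoint K → K
  | some a => a
  | none => 0

theorem coe_lineParam (t : OnePoint K) :
    (lineParam K t : RatFunc K) = lineCoord K t - algebraMap K (RatFunc K) (lineValue K t) := by
  rcases t with _ | a
  · change RatFunc.X⁻¹ = RatFunc.X⁻¹ - algebraMap K (RatFunc K) 0
    simp
  · rfl

theorem transcendental_lineCoord (t : OnePoint K) : Transcendental K (lineCoord K t) := by
  rcases t with _ | a
  · exact fun h => RatFunc.transcendental_X (inv_inv (RatFunc.X : RatFunc K) ▸ h.inv)
  · exact RatFunc.transcendental_X

theorem adjoin_lineCoord (t : OnePoint K) :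
    IntermediateField.adjoin K {lineCoord K t} = ⊤ := by
  refine top_unique (RatFunc.adjoin_X (K := K) ▸ ?_)
  rw [IntermediateField.adjoin_le_iff, Set.singleton_subset_iff]
  rcases t with _ | a
  · have := inv_mem (IntermediateField.mem_adjoin_simple_self K (lineCoord K none))
    rwa [show (lineCoord K none)⁻¹ = RatFunc.X from inv_inv _] at this
  · exact IntermediateField.mem_adjoin_simple_self K _

/-- The coordinate ring around a point is a polynomial ring in the affine coordinate. -/
def lineRingEquiv (t : OnePoint K) : K[X] ≃ₐ[K] lineRing K t :=
  algEquivOfTranscendental K (lineCoord K t) (transcendental_lineCoord K t)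

theorem coe_lineRingEquiv (t : OnePoint K) (p : K[X]) :
    (lineRingEquiv K t p : RatFunc K) = aeval (lineCoord K t) p := by
  have : (lineRing K t).val.comp (lineRingEquiv K t).toAlgHom = aeval (lineCoord K t) := by
    ext
    rw [aeval_X]
    exact congrArg Subtype.val 
      (algEquivOfTranscendental_apply_X K (lineCoord K t) (transcendental_lineCoord K t))
  exact DFunLike.congr_fun this p

instance isPrincipalIdealRing_lineRing (t : OnePoint K) : IsPrincipalIdealRing (lineRing K t) :=
  IsPrincipalIdealRing.of_surjective (lineRingEquiv K t) (lineRingEquiv K t).surjective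

instance isFractionRing_lineRing (t : OnePoint K) :
    IsFractionRing (lineRing K t) (RatFunc K) :=
  .of_field _ _ fun x => by
    have hx : x ∈ IntermediateField.adjoin K {lineCoord K t} := by
      rw [adjoin_lineCoord]; trivial
    obtain ⟨y, hy, z, hz, h⟩ := IntermediateField.mem_adjoin_iff_div.mp hx
    exact ⟨⟨y, hy⟩, ⟨z, hz⟩, h⟩

/-- Evaluation at the point `t` of the functions regular around `t`. -/
def lineEval (t : OnePoint K) : lineRing K t →ₐ[K] K :=
  (aeval (lineValue K t)).comp (lineRingEquiv K t).symm.toAlgHom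

theorem lineEval_lineRingEquiv (t : OnePoint K) (p : K[X]) :
    lineEval K t (lineRingEquiv K t p) = p.eval (lineValue K t) := by
  simp [lineEval]

theorem lineParam_eq (t : OnePoint K) :
    lineParam K t = lineRingEquiv K t (X - C (lineValue K t)) := by
  apply Subtype.ext
  rw [coe_lineRingEquiv, coe_lineParam]
  simp

theorem ker_lineEval (t : OnePoint K) : RingHom.ker (lineEval K t) = lineIdeal K t := by
  ext x
  obtain ⟨p, rfl⟩ := (lineRingEquiv K t).surjective x
  rw [RingHom.mem_ker, lineEval_lineRingEquiv, lineIdeal, Ideal.mem_span_singleton, lineParam_eq,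
    map_dvd_iff, dvd_iff_isRoot, IsRoot]

theorem lineEval_surjective (t : OnePoint K) : Function.Surjective (lineEval K t) :=
  fun c => ⟨algebraMap K _ c, by simp⟩

instance isMaximal_lineIdeal (t : OnePoint K) : (lineIdeal K t).IsMaximal := by
  rw [← ker_lineEval]
  exact RingHom.ker_isMaximal_of_surjective _ (lineEval_surjective K t)

theorem lineParam_ne_zero (t : OnePoint K) : lineParam K t ≠ 0 := by
  rw [lineParam_eq, Ne, map_eq_zero_iff _ (lineRingEquiv K t).injective]
  exact X_sub_C_ne_zero _

end LineRing

/-! ### Change of constants for the coordinate rings -/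

section LineRingMap

open Polynomial

variable (k : Type u) [Field k] (L : Type v) [Field L] [Algebra k L]

theorem ratFuncIncl_algebraMap_polynomial (p : k[X]) :
    ratFuncIncl k L (algebraMap k[X] (RatFunc k) p) =
      algebraMap L[X] (RatFunc L) (p.map (algebraMap k L)) := by
  have := RatFunc.map_apply_div (mapRingHom (algebraMap k L))
    (nonZeroDivisors_le_comap_nonZeroDivisors_of_injective _
      (Polynomial.map_injective _ (algebraMap k L).injective)) p 1
  simpa [ratFuncIncl, RatFunc.coe_mapRingHom_eq_coe_map] using this

theorem ratFuncIncl_X : ratFuncIncl k L RatFunc.X = RatFunc.X := by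
  rw [← RatFunc.algebraMap_X, ratFuncIncl_algebraMap_polynomial, map_X, RatFunc.algebraMap_X]

theorem ratFuncIncl_algebraMap (c : k) :
    ratFuncIncl k L (algebraMap k (RatFunc k) c) =
      algebraMap L (RatFunc L) (algebraMap k L c) := by
  rw [IsScalarTower.algebraMap_apply k k[X] (RatFunc k), ratFuncIncl_algebraMap_polynomial,
    IsScalarTower.algebraMap_apply L L[X] (RatFunc L)]
  simp

/-- The inclusion `ℙ¹(k) → ℙ¹(L)`. -/
def pointIncl : OnePoint k → OnePoint L := OnePoint.map (algebraMap k L)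

theorem lineValue_pointIncl (t : OnePoint k) :
    lineValue L (pointIncl k L t) = algebraMap k L (lineValue k t) := by
  rcases t with _ | a
  · exact (map_zero _).symm
  · rfl

theorem ratFuncIncl_lineCoord (t : OnePoint k) :
    ratFuncIncl k L (lineCoord k t) = lineCoord L (pointIncl k L t) := by
  rcases t with _ | a
  · change ratFuncIncl k L RatFunc.X⁻¹ = RatFunc.X⁻¹
    rw [map_inv₀, ratFuncIncl_X]
  · exact ratFuncIncl_X k L

theorem ratFuncIncl_lineRingEquiv (t : OnePoint k) (p : k[X]) :
    ratFuncIncl k L (lineRingEquiv k t p) =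
      lineRingEquiv L (pointIncl k L t) (p.map (algebraMap k L)) := by
  rw [coe_lineRingEquiv, coe_lineRingEquiv, aeval_def, aeval_def, hom_eval₂, eval₂_map,
    ratFuncIncl_lineCoord]
  congr 1
  ext c
  exact ratFuncIncl_algebraMap k L c

theorem ratFuncIncl_mem_lineRing {t : OnePoint k} {f : RatFunc k} (hf : f ∈ lineRing k t) :
    ratFuncIncl k L f ∈ lineRing L (pointIncl k L t) := by
  obtain ⟨p, hp⟩ := (lineRingEquiv k t).surjective ⟨f, hf⟩
  rw [show f = lineRingEquiv k t p by rw [hp], ratFuncIncl_lineRingEquiv]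
  exact Subtype.prop _

theorem ratFuncIncl_lineParam (t : OnePoint k) :
    ratFuncIncl k L (lineParam k t) = lineParam L (pointIncl k L t) := by
  rw [lineParam_eq, lineParam_eq, ratFuncIncl_lineRingEquiv, lineValue_pointIncl]
  simp

/-- A rational function over `k` which is regular away from one point over an extension of `k`
is so over `k`, because divisibility of polynomials descends along field extensions. -/
theorem mem_lineRing_of_ratFuncIncl_mem {t : OnePoint k} {f : RatFunc k}
    (hf : ratFuncIncl k L f ∈ lineRing L (pointIncl k L t)) : f ∈ lineRing k t := by
  obtain ⟨a, b, hb, rfl⟩ := IsFractionRing.div_surjective (lineRing k t) f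
  obtain ⟨p, rfl⟩ := (lineRingEquiv k t).surjective a
  obtain ⟨q, rfl⟩ := (lineRingEquiv k t).surjective b
  obtain ⟨r, hr⟩ := (lineRingEquiv L (pointIncl k L t)).surjective ⟨_, hf⟩
  have hr' := congrArg Subtype.val hr
  have hq0 : (lineRingEquiv k t q : RatFunc k) ≠ 0 := by
    simpa using nonZeroDivisors.ne_zero hb
  change _ = ratFuncIncl k L ((lineRingEquiv k t p : RatFunc k) / lineRingEquiv k t q) at hr'
  rw [map_div₀, eq_div_iff ((_root_.map_ne_zero _).mpr hq0), ratFuncIncl_lineRingEquiv,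
    ratFuncIncl_lineRingEquiv, ← Subalgebra.coe_mul, ← map_mul, Subtype.coe_inj,
    (lineRingEquiv L (pointIncl k L t)).injective.eq_iff] at hr'
  obtain ⟨s, rfl⟩ : q ∣ p := (map_dvd_map' (algebraMap k L)).mp ⟨r, by rw [← hr', mul_comm]⟩
  change (lineRingEquiv k t (q * s) : RatFunc k) / lineRingEquiv k t q ∈ _
  rw [map_mul, Subalgebra.coe_mul, mul_div_cancel_left₀ _ hq0]
  exact Subtype.prop _

end LineRingMap

/-! ### The compositum `FL` -/

section Compositum

open Polynomial

variable {k : Type u} [Field k] {P : k[X][X]} {L : Type w} [Field L] [Algebra k L]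

theorem polyOverRatFunc_eq : polyOverRatFunc k P = specializeAt P (RatFunc.X : RatFunc k) := by
  rw [polyOverRatFunc, specializeAt]
  congr 1
  ext x
  · simp [← RatFunc.algebraMap_C]
  · simp

theorem specializeAt_X_map_ratFuncIncl :
    (specializeAt P (RatFunc.X : RatFunc k)).map (ratFuncIncl k L) =
      specializeAt P (RatFunc.X : RatFunc L) := by
  rw [specializeAt, specializeAt, Polynomial.map_map]
  congr 1
  ext x
  · simp only [AlgHom.toRingHom_eq_coe, RingHom.coe_comp, RingHom.coe_coe, Function.comp_apply,
      aeval_C, ratFuncIncl_algebraMap]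
    exact (IsScalarTower.algebraMap_apply k L (RatFunc L) x).symm
  · simp [ratFuncIncl_X]

variable {F : Type v} [Field F] [Algebra (RatFunc k) F]
  (hF : (polyOverRatFunc k P).IsSplittingField (RatFunc k) F)
  {M : Type*} [Field M] [Algebra (RatFunc L) M] {φ : F →+* M}
  (hφ : φ.comp (algebraMap (RatFunc k) F) = (algebraMap (RatFunc L) M).comp (ratFuncIncl k L))

include hφ in
theorem map_algebraMap_of_comp_eq (x : RatFunc k) :
    φ (algebraMap (RatFunc k) F x) = algebraMap (RatFunc L) M (ratFuncIncl k L x) :=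
  DFunLike.congr_fun hφ x

include hφ in
theorem specializeAt_map_of_comp_eq :
    ((polyOverRatFunc k P).map (algebraMap (RatFunc k) F)).map φ =
      (specializeAt P (RatFunc.X : RatFunc L)).map (algebraMap (RatFunc L) M) := by
  rw [Polynomial.map_map, hφ, ← Polynomial.map_map, polyOverRatFunc_eq,
    specializeAt_X_map_ratFuncIncl]

include hF hφ in
/-- The roots of `P` in an extension of `L(T)` are the images of the roots in `F` under any
embedding of `F`. -/
theorem rootSet_eq_image :
    (specializeAt P (RatFunc.X : RatFunc L)).rootSet M =
      φ '' (polyOverRatFunc k P).rootSet F := by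
  classical
  rw [rootSet_def, rootSet_def, aroots_def, aroots_def, ← specializeAt_map_of_comp_eq hφ,
    Polynomial.Splits.roots_map hF.splits' φ]
  ext x
  simp

include hF hφ in
theorem range_le_of_rootSet_subset (S : Subalgebra (RatFunc L) M)
    (hS : (specializeAt P (RatFunc.X : RatFunc L)).rootSet M ⊆ S) (x : F) : φ x ∈ S := by
  have hx : x ∈ Algebra.adjoin (RatFunc k) ((polyOverRatFunc k P).rootSet F) := by
    rw [hF.adjoin_rootSet']; trivial
  induction hx using Algebra.adjoin_induction with
  | mem x hx => exact hS (rootSet_eq_image hF hφ ▸ ⟨x, hx, rfl⟩)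
  | algebraMap r => rw [map_algebraMap_of_comp_eq hφ]; exact S.algebraMap_mem _
  | add x y _ _ hx hy => rw [map_add]; exact add_mem hx hy
  | mul x y _ _ hx hy => rw [map_mul]; exact mul_mem hx hy

include hF hφ in
theorem top_le_span_image_basis
    (hM : (specializeAt P (RatFunc.X : RatFunc L)).IsSplittingField (RatFunc L) M)
    {ι : Type*} (b : Module.Basis ι (RatFunc k) F) :
    ⊤ ≤ Submodule.span (RatFunc L) (Set.range (φ ∘ b)) := by
  have h1 : Algebra.adjoin (RatFunc L) (Set.range φ) = ⊤ := by
    refine top_unique (hM.adjoin_rootSet' ▸ Algebra.adjoin_mono ?_)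
    rw [rootSet_eq_image hF hφ]
    exact Set.image_subset_range _ _
  have h2 := Algebra.adjoin_eq_span (RatFunc L) (Set.range φ)
  rw [h1, show Submonoid.closure (Set.range φ) = MonoidHom.mrange φ from
    Submonoid.closure_eq (MonoidHom.mrange (φ : F →* M)), Algebra.top_toSubmodule] at h2
  rw [h2, Submodule.span_le]
  rintro _ ⟨x, rfl⟩
  change φ x ∈ Submodule.span _ _
  have hx : x ∈ Submodule.span (RatFunc k) (Set.range b) := by rw [b.span_eq]; trivial
  induction hx using Submodule.span_induction with
  | mem x hx => obtain ⟨i, rfl⟩ := hx; exact Submodule.subset_span ⟨i, rfl⟩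
  | zero => rw [map_zero]; exact zero_mem _
  | add x y _ _ hx hy => rw [map_add]; exact add_mem hx hy
  | smul c x _ hx =>
    rw [Algebra.smul_def, map_mul, map_algebraMap_of_comp_eq hφ, ← Algebra.smul_def]
    exact Submodule.smul_mem _ _ hx

include hF hφ in
theorem finrank_le_of_isSplittingField
    (hM : (specializeAt P (RatFunc.X : RatFunc L)).IsSplittingField (RatFunc L) M) :
    Module.finrank (RatFunc L) M ≤ Module.finrank (RatFunc k) F := by
  have : FiniteDimensional (RatFunc k) F := hF.finiteDimensional
  let b := Module.finBasis (RatFunc k) F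
  have h := top_le_span_image_basis hF hφ hM b
  have h2 := finrank_range_le_card (R := RatFunc L) (φ ∘ b)
  rwa [Set.finrank, top_unique h, finrank_top, Fintype.card_fin] at h2

include hF hφ in
/-- If `F` and `L(T)` are linearly disjoint over `k(T)`, then a `k(T)`-linearly independent family
of `F` remains so over `L(T)`. -/
theorem linearIndependent_map_of_finrank_eq
    (hM : (specializeAt P (RatFunc.X : RatFunc L)).IsSplittingField (RatFunc L) M)
    (hn : Module.finrank (RatFunc L) M = Module.finrank (RatFunc k) F)
    {ι : Type*} {v : ι → F} (hv : LinearIndependent (RatFunc k) v) :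
    LinearIndependent (RatFunc L) (φ ∘ v) := by
  classical
  have : FiniteDimensional (RatFunc k) F := hF.finiteDimensional
  let b := Module.Basis.extend hv.linearIndepOn_id
  have := FiniteDimensional.fintypeBasisIndex b
  have h1 := linearIndependent_of_top_le_span_of_card_eq_finrank
    (top_le_span_image_basis hF hφ hM b) (by rw [hn, Module.finrank_eq_card_basis b])
  have h2 := h1.comp
    (fun i => ⟨v i, hv.linearIndepOn_id.subset_extend (Set.subset_univ _) ⟨i, rfl⟩⟩)
    fun i j h => hv.injective (congrArg Subtype.val h)
  convert h2 using 1
  funext i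
  simp [b]

variable (L)

include hF in
theorem exists_embedding_algebraicClosure : ∃ φ : F →+* AlgebraicClosure (RatFunc L),
    φ.comp (algebraMap (RatFunc k) F) =
      (algebraMap (RatFunc L) (AlgebraicClosure (RatFunc L))).comp (ratFuncIncl k L) := by
  let : Algebra (RatFunc k) (AlgebraicClosure (RatFunc L)) :=
    ((algebraMap (RatFunc L) (AlgebraicClosure (RatFunc L))).comp (ratFuncIncl k L)).toAlgebra
  have : FiniteDimensional (RatFunc k) F := hF.finiteDimensional
  let φ : F →ₐ[RatFunc k] AlgebraicClosure (RatFunc L) := IsAlgClosed.lift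
  exact ⟨φ, RingHom.ext fun x => φ.commutes x⟩

include hF in
theorem compositum_eq_adjoin_rootSet :
    compositum k F L = IntermediateField.adjoin (RatFunc L)
      ((specializeAt P (RatFunc.X : RatFunc L)).rootSet (AlgebraicClosure (RatFunc L))) := by
  apply le_antisymm
  · refine IntermediateField.adjoin_le_iff.mpr ?_
    rintro _ ⟨φ, hφ, x, rfl⟩
    exact range_le_of_rootSet_subset hF hφ (IntermediateField.toSubalgebra _)
      (IntermediateField.subset_adjoin _ _) x
  · obtain ⟨φ, hφ⟩ := exists_embedding_algebraicClosure L hF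
    rw [rootSet_eq_image hF hφ]
    refine IntermediateField.adjoin.mono _ _ _ ?_
    rintro _ ⟨x, -, rfl⟩
    exact ⟨φ, hφ, x, rfl⟩

include hF in
/-- The compositum `FL` is the splitting field of `P` over `L(T)`. -/
theorem compositum_isSplittingField :
    (specializeAt P (RatFunc.X : RatFunc L)).IsSplittingField (RatFunc L) (compositum k F L) := by
  rw [compositum_eq_adjoin_rootSet L hF]
  exact IntermediateField.adjoin_rootSet_isSplittingField (IsAlgClosed.splits _)

include hF in
theorem exists_embedding_compositum : ∃ φ : F →+* compositum k F L,
    φ.comp (algebraMap (RatFunc k) F) =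
      (algebraMap (RatFunc L) (compositum k F L)).comp (ratFuncIncl k L) := by
  obtain ⟨φ, hφ⟩ := exists_embedding_algebraicClosure L hF
  refine ⟨φ.codRestrict (compositum k F L)
    fun x => IntermediateField.subset_adjoin _ _ ⟨φ, hφ, x, rfl⟩, RingHom.ext fun x => ?_⟩
  exact Subtype.ext (DFunLike.congr_fun hφ x)

end Compositum

/-! ### Residue extensions at a rational point of a line

Here `A` is a `K`-algebra with a `K`-point `ev : A → K` whose kernel is generated by `π`, and `B`
is an `A`-algebra, in the applications finite and free. -/

section Residue

open Polynomial

variable {K A B : Type*} [Field K] [CommRing A] [CommRing B] [Algebra K A] [Algebra A B]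
  [Algebra K B] [IsScalarTower K A B] {π : A} {ev : A →ₐ[K] K} {I : Ideal B}

/-- Modulo an ideal above the ideal of a point, functions are congruent to their values. -/
theorem mk_algebraMap_eq_eval (hev : RingHom.ker ev = Ideal.span {π}) (hI : algebraMap A B π ∈ I)
    (x : A) : Ideal.Quotient.mk I (algebraMap A B x) = algebraMap K (B ⧸ I) (ev x) := by
  have hx : x - algebraMap K A (ev x) ∈ Ideal.span {π} := by
    rw [← hev, RingHom.mem_ker, map_sub, AlgHom.commutes, sub_eq_zero]
    rfl
  obtain ⟨y, hy⟩ := Ideal.mem_span_singleton.mp hx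
  rw [IsScalarTower.algebraMap_apply K B (B ⧸ I), Ideal.Quotient.algebraMap_eq,
    IsScalarTower.algebraMap_apply K A B, ← sub_eq_zero, ← map_sub, ← map_sub,
    Ideal.Quotient.eq_zero_iff_mem, hy, map_mul]
  exact I.mul_mem_right _ hI

theorem mk_smul_eq_eval_smul (hev : RingHom.ker ev = Ideal.span {π}) (hI : algebraMap A B π ∈ I)
    (x : A) (y : B) : Ideal.Quotient.mk I (x • y) = ev x • Ideal.Quotient.mk I y := by
  rw [Algebra.smul_def, map_mul, mk_algebraMap_eq_eval hev hI, ← Algebra.smul_def]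

variable {n : ℕ} (b : Module.Basis (Fin n) A B)

theorem top_le_span_mk_basis (hev : RingHom.ker ev = Ideal.span {π}) (hI : algebraMap A B π ∈ I) :
    ⊤ ≤ Submodule.span K (Set.range fun i => Ideal.Quotient.mk I (b i)) := by
  rintro x -
  obtain ⟨y, rfl⟩ := Ideal.Quotient.mk_surjective x
  rw [← b.sum_repr y, map_sum]
  refine Submodule.sum_mem _ fun i _ => ?_
  rw [mk_smul_eq_eval_smul hev hI]
  exact Submodule.smul_mem _ _ (Submodule.subset_span ⟨i, rfl⟩)

include b in
theorem finite_residue (hev : RingHom.ker ev = Ideal.span {π}) (hI : algebraMap A B π ∈ I) :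
    Module.Finite K (B ⧸ I) :=
  ⟨⟨(Set.finite_range _).toFinset, by simpa using top_unique (top_le_span_mk_basis b hev hI)⟩⟩

include b in
theorem finrank_residue_le (hev : RingHom.ker ev = Ideal.span {π}) (hI : algebraMap A B π ∈ I) :
    Module.finrank K (B ⧸ I) ≤ n := by
  have h := finrank_range_le_card (R := K) fun i => Ideal.Quotient.mk I (b i)
  rwa [Set.finrank, top_unique (top_le_span_mk_basis b hev hI), finrank_top, Fintype.card_fin] at h

include b in
/-- A point whose residue extension has the full degree is inert: the prime ideal above it is
generated by the local parameter. -/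
theorem dvd_of_mem_of_finrank_residue_eq (hev : RingHom.ker ev = Ideal.span {π})
    (hI : algebraMap A B π ∈ I) (hn : n ≤ Module.finrank K (B ⧸ I)) {x : B} (hx : x ∈ I) :
    algebraMap A B π ∣ x := by
  have hli := linearIndependent_of_top_le_span_of_card_eq_finrank (top_le_span_mk_basis b hev hI)
    (by rw [Fintype.card_fin]; exact le_antisymm hn (finrank_residue_le b hev hI))
  have h0 : ∑ i, ev (b.repr x i) • Ideal.Quotient.mk I (b i) = 0 := by
    rw [← Ideal.Quotient.eq_zero_iff_mem, ← b.sum_repr x, map_sum] at hx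
    rw [← hx]
    exact Finset.sum_congr rfl fun i _ => (mk_smul_eq_eval_smul hev hI _ _).symm
  rw [← b.sum_repr x]
  refine Finset.dvd_sum fun i _ => ?_
  have h1 : b.repr x i ∈ Ideal.span {π} := by
    rw [← hev]; exact Fintype.linearIndependent_iff.mp hli _ h0 i
  obtain ⟨y, hy⟩ := Ideal.mem_span_singleton.mp h1
  rw [hy, Algebra.smul_def, map_mul, mul_assoc]
  exact dvd_mul_right _ _

include b in
/-- If every element is congruent to a constant modulo the local parameter of some point,
then the extension is trivial. -/
theorem rank_le_one_of_forall_dvd_sub (hev : RingHom.ker ev = Ideal.span {π})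
    (h : ∀ x : B, ∃ c : K, algebraMap A B π ∣ x - algebraMap K B c) : n ≤ 1 := by
  let I : Ideal B := Ideal.span {algebraMap A B π}
  have hI : algebraMap A B π ∈ I := Ideal.mem_span_singleton_self _
  -- A basis stays linearly independent modulo the parameter.
  have hli : LinearIndependent K fun i => Ideal.Quotient.mk I (b i) := by
    refine Fintype.linearIndependent_iff.mpr fun c hc i => ?_
    have h1 : ∑ i, algebraMap K A (c i) • b i ∈ I := by
      rw [← Ideal.Quotient.eq_zero_iff_mem, map_sum, ← hc]
      refine Finset.sum_congr rfl fun i _ => ?_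
      rw [mk_smul_eq_eval_smul hev hI, AlgHom.commutes]
      rfl
    obtain ⟨y, hy⟩ := Ideal.mem_span_singleton.mp h1
    rw [← Algebra.smul_def] at hy
    have h2 := congrArg (fun z => b.repr z i) hy
    rw [map_smul] at h2
    simp only [Module.Basis.repr_sum_self, Finsupp.smul_apply] at h2
    have h3 : algebraMap K A (c i) ∈ Ideal.span {π} := Ideal.mem_span_singleton.mpr ⟨_, h2⟩
    rw [← hev, RingHom.mem_ker, AlgHom.commutes] at h3
    exact h3
  have hspan : ⊤ ≤ Submodule.span K (Set.range fun _ : Fin 1 => (1 : B ⧸ I)) := by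
    rintro x -
    obtain ⟨y, rfl⟩ := Ideal.Quotient.mk_surjective x
    obtain ⟨c, hc⟩ := h y
    have h1 : Ideal.Quotient.mk I y = c • (1 : B ⧸ I) := by
      rw [← Algebra.algebraMap_eq_smul_one, IsScalarTower.algebraMap_apply K B (B ⧸ I),
        Ideal.Quotient.algebraMap_eq, Ideal.Quotient.mk_eq_mk_iff_sub_mem]
      exact Ideal.mem_span_singleton.mpr hc
    rw [h1]
    exact Submodule.smul_mem _ _ (Submodule.subset_span ⟨0, rfl⟩)
  have := finite_residue b hev hI
  have h2 := finrank_range_le_card (R := K) fun _ : Fin 1 => (1 : B ⧸ I)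
  rw [Set.finrank, top_unique hspan, finrank_top, Fintype.card_fin] at h2
  have h3 := hli.fintype_card_le_finrank
  rw [Fintype.card_fin] at h3
  exact h3.trans h2

variable {f : A[X]} {s : Multiset B}

theorem map_eval_map_residue (hev : RingHom.ker ev = Ideal.span {π}) (hI : algebraMap A B π ∈ I)
    (hs : f.map (algebraMap A B) = (s.map fun r => X - C r).prod) :
    (f.map ev.toRingHom).map (algebraMap K (B ⧸ I)) =
      ((s.map (Ideal.Quotient.mk I)).map fun r => X - C r).prod := by
  have h1 := congrArg (Polynomial.map (Ideal.Quotient.mk I)) hs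
  rw [Polynomial.map_map, Polynomial.map_multiset_prod, Multiset.map_map] at h1
  simp only [Function.comp_def, Polynomial.map_sub, map_X, map_C] at h1
  rw [Multiset.map_map]
  refine Eq.trans ?_ h1
  rw [Polynomial.map_map]
  congr 1
  exact RingHom.ext fun x => (mk_algebraMap_eq_eval hev hI x).symm

include b in
/-- If `E/K` is the splitting field of the specialization of a polynomial which splits over `B`,
and the degree of `E/K` is at least the rank of `B`, then `E` is isomorphic to the
residue field of `B`: it embeds into it, and the degree of the latter is at most this rank. -/
theorem nonempty_algEquiv_residue (hev : RingHom.ker ev = Ideal.span {π}) [I.IsMaximal]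
    (hI : algebraMap A B π ∈ I) (hs : f.map (algebraMap A B) = (s.map fun r => X - C r).prod)
    {E : Type*} [Field E] [Algebra K E] (hE : (f.map ev.toRingHom).IsSplittingField K E)
    (hn : n ≤ Module.finrank K E) : Nonempty (E ≃ₐ[K] (B ⧸ I)) := by
  let := Ideal.Quotient.field I
  have hsplit : ((f.map ev.toRingHom).map (algebraMap K (B ⧸ I))).Splits := by
    rw [map_eval_map_residue hev hI hs]
    refine Splits.multisetProd fun f hf => ?_
    obtain ⟨r, -, rfl⟩ := Multiset.mem_map.mp hf
    exact Splits.X_sub_C _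
  let ψ : E →ₐ[K] (B ⧸ I) := IsSplittingField.lift E (f.map ev.toRingHom) hsplit
  have := finite_residue b hev hI
  have : FiniteDimensional K E := hE.finiteDimensional
  have hψ : Function.Injective ψ := ψ.toRingHom.injective
  have hsurj : Function.Surjective ψ.toLinearMap :=
    (LinearMap.injective_iff_surjective_of_finrank_eq_finrank
      (le_antisymm (LinearMap.finrank_le_finrank_of_injective (f := ψ.toLinearMap) hψ)
        ((finrank_residue_le b hev hI).trans hn))).mp hψ
  exact ⟨AlgEquiv.ofBijective ψ ⟨hψ, hsurj⟩⟩

omit [Algebra K A] [Algebra K B] [IsScalarTower K A B] in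
/-- A monic polynomial over `A` which splits over a field `M` is a product of linear factors over
the integral closure of `A` in `M`. -/
theorem exists_multiset_map_eq_prod {M : Type*} [Field M] [Algebra A M] [Algebra B M]
    [IsScalarTower A B M] [IsIntegralClosure B A M] (hf : f.Monic)
    (hM : (f.map (algebraMap A M)).Splits) : ∃ s : Multiset B,
      f.map (algebraMap A B) = (s.map fun r => X - C r).prod ∧
      s.map (algebraMap B M) = (f.map (algebraMap A M)).roots := by
  have hint (r : M) (hr : r ∈ (f.map (algebraMap A M)).roots) : IsIntegral A r :=
    ⟨f, hf, by rw [eval₂_eq_eval_map]; exact (mem_roots'.mp hr).2⟩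
  obtain ⟨s, hs⟩ : ∃ s : Multiset B, s.map (algebraMap B M) = (f.map (algebraMap A M)).roots :=
    ⟨(f.map (algebraMap A M)).roots.attach.map fun r => IsIntegralClosure.mk' B r.1
      (hint r.1 r.2), by
      rw [Multiset.map_map]
      simp only [Function.comp_def, IsIntegralClosure.algebraMap_mk']
      exact Multiset.attach_map_val _⟩
  refine ⟨s, ?_, hs⟩
  apply Polynomial.map_injective (algebraMap B M) (IsIntegralClosure.algebraMap_injective B A M)
  rw [Polynomial.map_map, ← IsScalarTower.algebraMap_eq,
    hM.eq_prod_roots_of_monic (hf.map _), Polynomial.map_multiset_prod, Multiset.map_map,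
    ← hs, Multiset.map_map]
  congr 2
  funext r
  simp

end Residue

/-! ### Residue extensions of splitting fields at separable specializations -/

section SeparableResidue

open Polynomial

variable {K A B : Type*} [Field K] [CommRing A] [CommRing B] [Algebra K A] [Algebra A B]
  [Algebra K B] [IsScalarTower K A B] {π : A} {ev : A →ₐ[K] K}

/-- Let `M` be the splitting field of a monic polynomial `f` over the integrally closed domain `A`,
and `E` the residue field of the integral closure of `A` at a prime ideal above a rational point
of `A`. If `f` is separable at this point, then `E` is the splitting field of the
specialized polynomial. Indeed, an automorphism of `E` lifts to an element of the decomposition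
group; if it fixes the roots of the specialization, then the lift fixes the roots of `f`, as
these remain distinct. -/
theorem isSplittingField_residue (K' M : Type*) [Field K'] [Field M] [Algebra A K']
    [IsFractionRing A K'] [IsDomain A] [IsIntegrallyClosed A] [Algebra K' M] [Algebra A M]
    [IsScalarTower A K' M] [Algebra B M] [IsScalarTower A B M] [IsIntegralClosure B A M]
    [FiniteDimensional K' M] [IsGalois K' M]
    (hev : RingHom.ker ev = Ideal.span {π}) (𝔓 : Ideal B) [𝔓.IsPrime]
    [𝔓.LiesOver (Ideal.span {π})] {f : A[X]} (hf : f.Monic)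
    (hM : (f.map (algebraMap A K')).IsSplittingField K' M)
    (hsep : (f.map ev.toRingHom).Separable)
    {E : Type*} [Field E] [Algebra K E] [FiniteDimensional K E] [IsGalois K E]
    (e : E ≃ₐ[K] (B ⧸ 𝔓)) : (f.map ev.toRingHom).IsSplittingField K E := by
  classical
  have hI : algebraMap A B π ∈ 𝔓 :=
    (Ideal.mem_of_liesOver 𝔓 (Ideal.span {π}) π).mp (Ideal.mem_span_singleton_self π)
  have hsplit : (f.map (algebraMap A M)).Splits := by
    have := hM.splits'
    rwa [Polynomial.map_map, ← IsScalarTower.algebraMap_eq] at this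
  obtain ⟨s, hs, hsM⟩ := exists_multiset_map_eq_prod (B := B) hf hsplit
  have hres := map_eval_map_residue hev hI hs
  have hprod : ((f.map ev.toRingHom).map (algebraMap K (B ⧸ 𝔓))).roots =
      s.map (Ideal.Quotient.mk 𝔓) := by
    rw [hres, roots_multiset_prod_X_sub_C]
  have hnodup : (s.map (Ideal.Quotient.mk 𝔓)).Nodup := hprod ▸ nodup_roots hsep.map
  have hmk (r : B) (hr : r ∈ s) :
      e.symm (Ideal.Quotient.mk 𝔓 r) ∈ (f.map ev.toRingHom).rootSet E := by
    have h1 : Ideal.Quotient.mk 𝔓 r ∈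
        ((f.map ev.toRingHom).map (algebraMap K (B ⧸ 𝔓))).roots :=
      hprod ▸ Multiset.mem_map_of_mem _ hr
    rw [mem_rootSet']
    refine ⟨((hf.map _).map _).ne_zero, ?_⟩
    rw [aeval_algHom_apply e.symm, aeval_def, eval₂_eq_eval_map, (mem_roots'.mp h1).2, map_zero]
  have hsplitE : ((f.map ev.toRingHom).map (algebraMap K E)).Splits := by
    have : ((f.map ev.toRingHom).map (algebraMap K (B ⧸ 𝔓))).Splits := by
      rw [hres]
      refine Splits.multisetProd fun f hf => ?_
      obtain ⟨r, -, rfl⟩ := Multiset.mem_map.mp hf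
      exact Splits.X_sub_C _
    have h2 := this.map (e.symm : (B ⧸ 𝔓) →+* E)
    rwa [Polynomial.map_map, show (e.symm : (B ⧸ 𝔓) →+* E).comp (algebraMap K (B ⧸ 𝔓)) =
      algebraMap K E from RingHom.ext fun c => e.symm.commutes c] at h2
  refine isSplittingField_of_forall_fix_eq_one hsplitE fun σ hσ => ?_
  have : IsDomain B := (IsIntegralClosure.algebraMap_injective B A M).isDomain (algebraMap B M)
  have := IsIntegralClosure.isFractionRing_of_finite_extension A K' M B
  let := IsIntegralClosure.MulSemiringAction A K' M B
  have hsmul (g : M ≃ₐ[K'] M) (b : B) : g • b = galRestrict A K' M B g b := rfl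
  have : SMulCommClass (M ≃ₐ[K'] M) A B := ⟨fun g a b => by rw [hsmul, map_smul, hsmul]⟩
  have := Algebra.isInvariant_of_isGalois A K' M B
  let τ : (B ⧸ 𝔓) ≃ₐ[A ⧸ Ideal.span {π}] (B ⧸ 𝔓) :=
    AlgEquiv.ofRingEquiv (f := ((e.symm.trans σ).trans e).toRingEquiv) fun x => by
      obtain ⟨a, rfl⟩ := Ideal.Quotient.mk_surjective x
      change ((e.symm.trans σ).trans e) (Ideal.Quotient.mk 𝔓 (algebraMap A B a)) =
        Ideal.Quotient.mk 𝔓 (algebraMap A B a)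
      rw [mk_algebraMap_eq_eval hev hI, AlgEquiv.commutes]
  have hτ (x : B ⧸ 𝔓) : τ x = e (σ (e.symm x)) := rfl
  obtain ⟨⟨g, hg⟩, hgτ⟩ :=
    Ideal.Quotient.stabilizerHom_surjective (M ≃ₐ[K'] M) (Ideal.span {π}) 𝔓 τ
  have hgmk (b : B) : Ideal.Quotient.mk 𝔓 (g • b) = τ (Ideal.Quotient.mk 𝔓 b) := by
    rw [← hgτ]; rfl
  have hgM (b : B) : algebraMap B M (g • b) = g (algebraMap B M b) := by
    rw [hsmul, algebraMap_galRestrict_apply]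
  have hmem (b : B) : b ∈ s ↔ aeval (algebraMap B M b) (f.map (algebraMap A K')) = 0 := by
    rw [aeval_map_algebraMap, ← Multiset.mem_map_of_injective
      (IsIntegralClosure.algebraMap_injective B A M), hsM, mem_roots (hf.map _).ne_zero, IsRoot,
      eval_map_algebraMap]
  have hfix (r : B) (hr : r ∈ s) : g • r = r := by
    have hgr : g • r ∈ s := by
      rw [hmem, hgM, aeval_algHom_apply g, (hmem r).mp hr, map_zero]
    refine Multiset.inj_on_of_nodup_map hnodup _ hgr _ hr ?_
    rw [hgmk, hτ, hσ _ (hmk r hr), AlgEquiv.apply_symm_apply]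
  have hg1 : (g : M →ₐ[K'] M) = AlgHom.id K' M := by
    refine AlgHom.ext_of_adjoin_eq_top hM.adjoin_rootSet' fun y hy => ?_
    rw [rootSet_def, aroots_def, Polynomial.map_map, ← IsScalarTower.algebraMap_eq, ← hsM,
      Finset.mem_coe, Multiset.mem_toFinset] at hy
    obtain ⟨r, hr, rfl⟩ := Multiset.mem_map.mp hy
    exact (hgM r).symm.trans (congrArg _ (hfix r hr))
  have hg1' : g = 1 := AlgEquiv.ext fun x => DFunLike.congr_fun hg1 x
  refine AlgEquiv.ext fun x => ?_
  obtain ⟨b, hb⟩ := Ideal.Quotient.mk_surjective (e x)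
  have h1 := hgmk b
  rw [hg1', one_smul, hτ, hb, AlgEquiv.symm_apply_apply, e.injective.eq_iff] at h1
  exact h1.symm

end SeparableResidue

/-! ### Residue extensions at constant points -/

section ConstantPoint

open Polynomial

theorem exists_basis_integralClosure (A K' M B : Type*) [CommRing A] [IsDomain A]
    [IsPrincipalIdealRing A] [Field K'] [Algebra A K'] [IsFractionRing A K'] [Field M]
    [Algebra K' M] [Algebra A M] [IsScalarTower A K' M] [CommRing B] [Algebra A B] [Algebra B M]
    [IsScalarTower A B M] [IsIntegralClosure B A M] [FiniteDimensional K' M]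
    [Algebra.IsSeparable K' M] :
    Nonempty (Module.Basis (Fin (Module.finrank K' M)) A B) := by
  have : IsDomain B := (IsIntegralClosure.algebraMap_injective B A M).isDomain (algebraMap B M)
  have : Module.Finite A B := IsIntegralClosure.finite A K' M B
  have : FaithfulSMul A M := by
    rw [faithfulSMul_iff_algebraMap_injective, IsScalarTower.algebraMap_eq A K' M]
    exact (algebraMap K' M).injective.comp (IsFractionRing.injective A K')
  have : FaithfulSMul A B := by
    rw [faithfulSMul_iff_algebraMap_injective]
    refine Function.Injective.of_comp (f := algebraMap B M) ?_
    rw [← RingHom.coe_comp, ← IsScalarTower.algebraMap_eq]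
    exact FaithfulSMul.algebraMap_injective A M
  have : Module.Free A B := inferInstance
  rw [← IsIntegralClosure.rank A K' M B]
  exact ⟨Module.finBasis _ _⟩

/-- A homomorphism compatible with a homomorphism of base rings maps integral closures to integral
closures. -/
theorem exists_ringHom_integralClosure {A₀ A F M B₀ B : Type*} [CommRing A₀] [CommRing A]
    [CommRing F] [CommRing M] [CommRing B₀] [CommRing B] [Algebra A₀ F] [Algebra A M]
    [Algebra A₀ B₀] [Algebra B₀ F] [IsScalarTower A₀ B₀ F] [IsIntegralClosure B₀ A₀ F]
    [Algebra A B] [Algebra B M] [IsScalarTower A B M] [IsIntegralClosure B A M]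
    {i : A₀ →+* A} {φ : F →+* M} (h : ∀ x, φ (algebraMap A₀ F x) = algebraMap A M (i x)) :
    ∃ ψ : B₀ →+* B, ∀ x, algebraMap B M (ψ x) = φ (algebraMap B₀ F x) := by
  have hint (x : B₀) : IsIntegral A (φ (algebraMap B₀ F x)) := by
    obtain ⟨q, hq, hqx⟩ := (IsIntegralClosure.isIntegral A₀ F x).map (IsScalarTower.toAlgHom A₀ B₀ F)
    refine ⟨q.map i, hq.map _, ?_⟩
    rw [eval₂_map, show (algebraMap A M).comp i = φ.comp (algebraMap A₀ F) from
      RingHom.ext fun x => (h x).symm, ← hom_eval₂]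
    exact (congrArg φ hqx).trans (map_zero φ)
  have hinj := IsIntegralClosure.algebraMap_injective B A M
  refine ⟨{ toFun := fun x => IsIntegralClosure.mk' B _ (hint x), map_one' := ?_, map_mul' := ?_,
            map_zero' := ?_, map_add' := ?_ }, fun x => IsIntegralClosure.algebraMap_mk' B _ (hint x)⟩
  all_goals intros; apply hinj; simp

variable {k : Type u} [Field k] {P : k[X][X]} {L : Type w} [Field L] [Algebra k L]
  {F : Type v} [Field F] [Algebra (RatFunc k) F]
  (hF : (polyOverRatFunc k P).IsSplittingField (RatFunc k) F)
  {M : Type*} [Field M] [Algebra (RatFunc L) M] {φ : F →+* M}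
  (hφ : φ.comp (algebraMap (RatFunc k) F) = (algebraMap (RatFunc L) M).comp (ratFuncIncl k L))
  (hM : (specializeAt P (RatFunc.X : RatFunc L)).IsSplittingField (RatFunc L) M)

variable (k L) in
/-- The inclusion of the coordinate ring around a point over `k` into the one over `L`. -/
def lineRingIncl (t : OnePoint k) : lineRing k t →+* lineRing L (pointIncl k L t) :=
  ((ratFuncIncl k L).comp (lineRing k t).val.toRingHom).codRestrict (lineRing L (pointIncl k L t))
    fun x => ratFuncIncl_mem_lineRing k L x.2

theorem lineEval_lineRingIncl (t : OnePoint k) (x : lineRing k t) :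
    lineEval L (pointIncl k L t) (lineRingIncl k L t x) = algebraMap k L (lineEval k t x) := by
  obtain ⟨p, rfl⟩ := (lineRingEquiv k t).surjective x
  have : lineRingIncl k L t (lineRingEquiv k t p) =
      lineRingEquiv L (pointIncl k L t) (p.map (algebraMap k L)) :=
    Subtype.ext (ratFuncIncl_lineRingEquiv k L t p)
  rw [this, lineEval_lineRingEquiv, lineEval_lineRingEquiv, lineValue_pointIncl, eval_map,
    eval₂_at_apply]

theorem lineRingIncl_lineParam (t : OnePoint k) :
    lineRingIncl k L t (lineParam k t) = lineParam L (pointIncl k L t) :=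
  Subtype.ext (ratFuncIncl_lineParam k L t)

include hφ in
theorem map_algebraMap_lineRing (t : OnePoint k) (x : lineRing k t) :
    φ (algebraMap (lineRing k t) F x) =
      algebraMap (lineRing L (pointIncl k L t)) M (lineRingIncl k L t x) :=
  map_algebraMap_of_comp_eq hφ x

include hF hφ hM in
/-- If `F` and `L(T)` are linearly disjoint over `k(T)`, then minimal polynomials do not change
under this extension of scalars. -/
theorem minpoly_map_eq_of_finrank_eq
    (hn : Module.finrank (RatFunc L) M = Module.finrank (RatFunc k) F) (c : F) :
    minpoly (RatFunc L) (φ c) = (minpoly (RatFunc k) c).map (ratFuncIncl k L) := by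
  have : FiniteDimensional (RatFunc k) F := hF.finiteDimensional
  have : FiniteDimensional (RatFunc L) M := hM.finiteDimensional
  have hc : IsIntegral (RatFunc k) c := Algebra.IsIntegral.isIntegral c
  have hφc : IsIntegral (RatFunc L) (φ c) := Algebra.IsIntegral.isIntegral _
  have hli := linearIndependent_map_of_finrank_eq hF hφ hM hn (linearIndependent_pow (K := RatFunc k) c)
  symm
  refine eq_of_monic_of_dvd_of_natDegree_le (minpoly.monic hφc) ((minpoly.monic hc).map _)
    (minpoly.dvd _ _ ?_) ?_
  · rw [aeval_def, eval₂_map, ← hφ, ← hom_eval₂, ← aeval_def, minpoly.aeval, map_zero]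
  · rw [natDegree_map]
    by_contra! hlt
    have h0 : ∑ i : Fin (minpoly (RatFunc k) c).natDegree,
        (minpoly (RatFunc L) (φ c)).coeff i • (φ ∘ fun i : Fin _ => c ^ (i : ℕ)) i = 0 := by
      rw [← minpoly.aeval (RatFunc L) (φ c), aeval_eq_sum_range' hlt, Finset.sum_range]
      simp
    have h1 := Fintype.linearIndependent_iff.mp hli _ h0 ⟨_, hlt⟩
    rw [Fin.val_mk, coeff_natDegree, (minpoly.monic hφc).leadingCoeff] at h1
    exact one_ne_zero h1

include hF hφ hM in
/-- Under linear disjointness, integrality over the coordinate ring around a point descends. -/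
theorem isIntegral_lineRing_of_map
    (hn : Module.finrank (RatFunc L) M = Module.finrank (RatFunc k) F) {t : OnePoint k} {c : F}
    (hc : IsIntegral (lineRing L (pointIncl k L t)) (φ c)) : IsIntegral (lineRing k t) c := by
  have : FiniteDimensional (RatFunc k) F := hF.finiteDimensional
  have hmin := minpoly_map_eq_of_finrank_eq hF hφ hM hn c
  rw [minpoly.isIntegrallyClosed_eq_field_fractions' (RatFunc L) hc] at hmin
  have hlift : minpoly (RatFunc k) c ∈ lifts (algebraMap (lineRing k t) (RatFunc k)) := by
    rw [lifts_iff_coeff_lifts]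
    intro i
    have hi := congrArg (fun p => coeff p i) hmin
    simp only [coeff_map] at hi
    have hmem : (minpoly (RatFunc k) c).coeff i ∈ lineRing k t := by
      apply mem_lineRing_of_ratFuncIncl_mem k L
      rw [← hi]
      exact Subtype.prop _
    exact ⟨⟨_, hmem⟩, rfl⟩
  obtain ⟨q, hq, -, hqm⟩ := lifts_and_natDegree_eq_and_monic hlift
    (minpoly.monic (Algebra.IsIntegral.isIntegral c))
  refine ⟨q, hqm, ?_⟩
  rw [IsScalarTower.algebraMap_eq (lineRing k t) (RatFunc k) F, ← eval₂_map, hq]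
  exact minpoly.aeval _ _

include hF hφ hM in
/-- If the residue extension of `M/L(T)` at a point of `ℙ¹(k)` has degree at least `[F : k(T)]`,
and `k` is algebraically closed in it, then `F/k(T)` is trivial. Indeed, the point is then inert
in `M/L(T)`, so that the fibre of `F/k(T)`, an algebra of dimension `[F : k(T)]` over `k`, embeds
into the residue extension. -/
theorem finrank_le_one_of_constant_point [CharZero k] [CharZero L] {t : OnePoint k}
    (B₀ : Type*) [CommRing B₀] [Algebra (lineRing k t) B₀] [Algebra k B₀]
    [IsScalarTower k (lineRing k t) B₀] [Algebra B₀ F] [IsScalarTower (lineRing k t) B₀ F]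
    [IsIntegralClosure B₀ (lineRing k t) F]
    (B : Type*) [CommRing B] [Algebra (lineRing L (pointIncl k L t)) B] [Algebra L B]
    [IsScalarTower L (lineRing L (pointIncl k L t)) B] [Algebra B M]
    [IsScalarTower (lineRing L (pointIncl k L t)) B M]
    [IsIntegralClosure B (lineRing L (pointIncl k L t)) M]
    (𝔓 : Ideal B) (h𝔓 : algebraMap _ B (lineParam L (pointIncl k L t)) ∈ 𝔓)
    {E : Type*} [Field E] [Algebra k E] [Algebra L E] [IsScalarTower k L E]
    (hE : ∀ x : E, IsAlgebraic k x → x ∈ (algebraMap k E).range)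
    (e : E ≃ₐ[L] (B ⧸ 𝔓)) (hdeg : Module.finrank (RatFunc k) F ≤ Module.finrank L E) :
    Module.finrank (RatFunc k) F ≤ 1 := by
  have : FiniteDimensional (RatFunc k) F := hF.finiteDimensional
  have : FiniteDimensional (RatFunc L) M := hM.finiteDimensional
  obtain ⟨b₀⟩ := exists_basis_integralClosure (lineRing k t) (RatFunc k) F B₀
  obtain ⟨b⟩ := exists_basis_integralClosure (lineRing L (pointIncl k L t)) (RatFunc L) M B
  have hev₀ : RingHom.ker (lineEval k t) = Ideal.span {lineParam k t} := ker_lineEval k t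
  have hev : RingHom.ker (lineEval L (pointIncl k L t)) =
      Ideal.span {lineParam L (pointIncl k L t)} := ker_lineEval L _
  have hdegM := finrank_le_of_isSplittingField hF hφ hM
  rw [e.toLinearEquiv.finrank_eq] at hdeg
  have hdegκ := finrank_residue_le b hev h𝔓
  have hinert {x : B} (hx : x ∈ 𝔓) := dvd_of_mem_of_finrank_residue_eq b hev h𝔓
    (hdegM.trans hdeg) hx
  have hn := le_antisymm hdegM (hdeg.trans hdegκ)
  have hBM := IsIntegralClosure.algebraMap_injective B (lineRing L (pointIncl k L t)) M
  have hBF := IsIntegralClosure.algebraMap_injective B₀ (lineRing k t) F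
  obtain ⟨ψ, hψ⟩ := exists_ringHom_integralClosure (B₀ := B₀) (B := B)
    (map_algebraMap_lineRing hφ t)
  have hψA (a : lineRing k t) :
      ψ (algebraMap _ B₀ a) = algebraMap _ B (lineRingIncl k L t a) := by
    apply hBM
    rw [hψ, ← IsScalarTower.algebraMap_apply, map_algebraMap_lineRing hφ,
      ← IsScalarTower.algebraMap_apply]
  have hmk (a : lineRing k t) : Ideal.Quotient.mk 𝔓 (ψ (algebraMap _ B₀ a)) =
      algebraMap L (B ⧸ 𝔓) (algebraMap k L (lineEval k t a)) := by
    rw [hψA, mk_algebraMap_eq_eval hev h𝔓, lineEval_lineRingIncl]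
  refine rank_le_one_of_forall_dvd_sub b₀ hev₀ fun x => ?_
  -- The residue of `x` is algebraic over `k`, thus a constant `c`.
  have halg : IsAlgebraic k (e.symm (Ideal.Quotient.mk 𝔓 (ψ x))) := by
    obtain ⟨q, hq, hqx⟩ := IsIntegralClosure.isIntegral (A := B₀) (lineRing k t) F x
    refine ⟨q.map (lineEval k t).toRingHom, (hq.map _).ne_zero, ?_⟩
    let g : B₀ →+* E := ((e.symm : (B ⧸ 𝔓) →+* E).comp (Ideal.Quotient.mk 𝔓)).comp ψ
    have hg : (algebraMap k E).comp (lineEval k t).toRingHom = g.comp (algebraMap _ B₀) := by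
      refine RingHom.ext fun a => ?_
      change algebraMap k E (lineEval k t a) =
        e.symm (Ideal.Quotient.mk 𝔓 (ψ (algebraMap _ B₀ a)))
      rw [hmk, AlgEquiv.commutes, ← IsScalarTower.algebraMap_apply]
    rw [aeval_def, eval₂_map, hg]
    change eval₂ (g.comp (algebraMap _ B₀)) (g x) q = 0
    rw [← hom_eval₂, hqx, map_zero]
  obtain ⟨c, hc⟩ := hE _ halg
  refine ⟨c, ?_⟩
  have hmem : ψ (x - algebraMap k B₀ c) ∈ 𝔓 := by
    rw [← Ideal.Quotient.eq_zero_iff_mem, map_sub, map_sub,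
      IsScalarTower.algebraMap_apply k (lineRing k t) B₀, hmk, AlgHom.commutes, sub_eq_zero,
      Algebra.algebraMap_self, RingHom.id_apply,
      ← e.apply_symm_apply (Ideal.Quotient.mk 𝔓 (ψ x)), ← hc,
      IsScalarTower.algebraMap_apply k L E, AlgEquiv.commutes]
  -- By inertness, the difference is divisible by the parameter in `B`, hence in `B₀`.
  obtain ⟨z, hz⟩ := hinert hmem
  have hπ₀ : algebraMap B₀ F (algebraMap _ B₀ (lineParam k t)) ≠ 0 := by
    rw [← IsScalarTower.algebraMap_apply, IsScalarTower.algebraMap_apply _ (RatFunc k) F]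
    simpa using lineParam_ne_zero k t
  have hquot : φ (algebraMap B₀ F (x - algebraMap k B₀ c) /
      algebraMap B₀ F (algebraMap _ B₀ (lineParam k t))) = algebraMap B M z := by
    rw [map_div₀, div_eq_iff ((_root_.map_ne_zero φ).mpr hπ₀), ← hψ, ← hψ, hz, hψA,
      lineRingIncl_lineParam, map_mul, mul_comm]
  have hint := isIntegral_lineRing_of_map hF hφ hM hn (t := t) (hquot ▸
    (IsIntegralClosure.isIntegral (lineRing L (pointIncl k L t)) M z).map
      (IsScalarTower.toAlgHom (lineRing L (pointIncl k L t)) B M))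
  refine ⟨IsIntegralClosure.mk' B₀ _ hint, hBF ?_⟩
  rw [map_mul, IsIntegralClosure.algebraMap_mk', mul_div_cancel₀ _ hπ₀]

end ConstantPoint

/-! ### Specialized extensions and specialized polynomials -/

section SpecializedExtensions

open Polynomial

variable {k : Type u} [Field k] {P : k[X][X]} {L : Type w} [Field L] [Algebra k L]

/-- The indeterminate `T` as an element of the coordinate ring `L[T]`. -/
def lineT (t₀ : L) : lineRing L (t₀ : OnePoint L) :=
  ⟨RatFunc.X, Algebra.self_mem_adjoin_singleton L _⟩

theorem lineEval_lineT (t₀ : L) : lineEval L t₀ (lineT t₀) = t₀ := by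
  have : lineT t₀ = lineRingEquiv L t₀ X := by
    apply Subtype.ext
    rw [coe_lineRingEquiv, aeval_X]
    rfl
  rw [this, lineEval_lineRingEquiv, eval_X]
  rfl

theorem specializeAt_lineT_map_algebraMap (P : k[X][X]) (t₀ : L) :
    (specializeAt P (lineT t₀)).map (algebraMap _ (RatFunc L)) =
      specializeAt P (RatFunc.X : RatFunc L) :=
  specializeAt_map P ((lineRing L (t₀ : OnePoint L)).val.restrictScalars k) (lineT t₀)

theorem specializeAt_lineT_map_lineEval (P : k[X][X]) (t₀ : L) :
    (specializeAt P (lineT t₀)).map (lineEval L (t₀ : OnePoint L)).toRingHom =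
      specializePoly k P t₀ := by
  refine (specializeAt_map P ((lineEval L (t₀ : OnePoint L)).restrictScalars k) (lineT t₀)).trans ?_
  rw [specializePoly_eq]
  congr 1
  exact lineEval_lineT t₀

theorem exists_ratFunc_algHom {t : L} (ht : Transcendental k t) :
    ∃ θ : RatFunc k →ₐ[k] L, θ RatFunc.X = t := by
  have hinj := transcendental_iff_injective.mp ht
  refine ⟨IsFractionRing.liftAlgHom (g := aeval (R := k) t) hinj, ?_⟩
  rw [← RatFunc.algebraMap_X, IsFractionRing.liftAlgHom_apply]
  exact (IsFractionRing.lift_algebraMap (A := k[X]) hinj X).trans (aeval_X t)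

theorem separable_specializePoly (hsep : (polyOverRatFunc k P).Separable) {t : L}
    (ht : Transcendental k t) : (specializePoly k P t).Separable := by
  obtain ⟨θ, rfl⟩ := exists_ratFunc_algHom ht
  rw [specializePoly_eq, ← specializeAt_map, ← polyOverRatFunc_eq]
  exact hsep.map

variable {M : Type v} [Field M] [Algebra (RatFunc L) M] [Algebra L M]
  [IsScalarTower L (RatFunc L) M]
  (hM : (specializeAt P (RatFunc.X : RatFunc L)).IsSplittingField (RatFunc L) M)
  {E : Type*} [Field E] [Algebra L E]

include hM in
/-- If the splitting field of `P(t₀,Y)` over `L` has degree at least `[M : L(T)]`, where `M` is the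
splitting field of `P` over `L(T)`, then it is the specialization of `M/L(T)` at `t₀`. -/
theorem isSpecialization_of_isSplittingField [CharZero L] (hP : P.Monic) {t₀ : L}
    (hE : (specializePoly k P t₀).IsSplittingField L E)
    (hn : Module.finrank (RatFunc L) M ≤ Module.finrank L E) :
    IsSpecialization L M (t₀ : OnePoint L) E := by
  have : FiniteDimensional (RatFunc L) M := hM.finiteDimensional
  let A := lineRing L (t₀ : OnePoint L)
  let B := integralClosure A M
  have : IsScalarTower A B M := IsScalarTower.of_algebraMap_eq fun _ => rfl
  obtain ⟨b⟩ := exists_basis_integralClosure A (RatFunc L) M B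
  have hint : Algebra.IsIntegral A B := IsIntegralClosure.isIntegral_algebra A M
  have : FaithfulSMul A B := (faithfulSMul_iff_algebraMap_injective A B).mpr fun x y h =>
    FaithfulSMul.algebraMap_injective A M (congrArg (algebraMap B M) h)
  obtain ⟨𝔓, hmax, hover⟩ :=
    Ideal.exists_maximal_ideal_liesOver_of_isIntegral (S := B) (lineIdeal L (t₀ : OnePoint L))
  have hI : algebraMap A B (lineParam L t₀) ∈ 𝔓 :=
    (Ideal.mem_of_liesOver 𝔓 (lineIdeal L (t₀ : OnePoint L)) _).mp
      (Ideal.mem_span_singleton_self _)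
  have hsplit : ((specializeAt P (lineT t₀)).map (algebraMap A M)).Splits := by
    rw [IsScalarTower.algebraMap_eq A (RatFunc L) M, ← Polynomial.map_map,
      specializeAt_lineT_map_algebraMap]
    exact hM.splits'
  obtain ⟨s, hs, -⟩ := exists_multiset_map_eq_prod (B := B) (specializeAt_monic hP _) hsplit
  exact ⟨𝔓, hmax.isPrime, hover, nonempty_algEquiv_residue b (ker_lineEval L _) hI hs
    ((specializeAt_lineT_map_lineEval P t₀).symm ▸ hE) hn⟩

include hM in
/-- The specialization of `M/L(T)` at a point `t₀` which is transcendental over `k` is the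
splitting field of `P(t₀,Y)`. -/
theorem isSplittingField_of_isSpecialization [CharZero L] (hP : P.Monic)
    (hsep : (polyOverRatFunc k P).Separable) {t₀ : L} (ht₀ : Transcendental k t₀)
    [FiniteDimensional L E] [IsGalois L E] (hE : IsSpecialization L M (t₀ : OnePoint L) E) :
    (specializePoly k P t₀).IsSplittingField L E := by
  have : FiniteDimensional (RatFunc L) M := hM.finiteDimensional
  have : IsGalois (RatFunc L) M := IsGalois.of_separable_splitting_field
    (p := specializeAt P (RatFunc.X : RatFunc L))
    (specializeAt_X_map_ratFuncIncl (k := k) (L := L) ▸ polyOverRatFunc_eq (k := k) (P := P) ▸ hsep.map)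
  obtain ⟨𝔓, hprime, hover, ⟨e⟩⟩ := hE
  have hM' : ((specializeAt P (lineT t₀)).map (algebraMap _ (RatFunc L))).IsSplittingField
      (RatFunc L) M := (specializeAt_lineT_map_algebraMap P t₀).symm ▸ hM
  have h := separable_specializePoly hsep ht₀
  rw [← specializeAt_lineT_map_lineEval] at h ⊢
  have : 𝔓.LiesOver (Ideal.span {lineParam L (t₀ : OnePoint L)}) := hover
  exact isSplittingField_residue (RatFunc L) M (ker_lineEval L _) 𝔓 (specializeAt_monic hP _) hM'
    h e

variable {F : Type*} [Field F] [Algebra (RatFunc k) F] [Algebra k F] [IsScalarTower k (RatFunc k) F]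
  (hF : (polyOverRatFunc k P).IsSplittingField (RatFunc k) F)

include hF hM in
theorem finrank_le_one_of_isSpecialization_pointIncl [CharZero k] [CharZero L] {φ : F →+* M}
    (hφ : φ.comp (algebraMap (RatFunc k) F) = (algebraMap (RatFunc L) M).comp (ratFuncIncl k L))
    [Algebra k E] [IsScalarTower k L E]
    (hk : ∀ x : E, IsAlgebraic k x → x ∈ (algebraMap k E).range)
    (hdeg : Module.finrank (RatFunc k) F ≤ Module.finrank L E) {t : OnePoint k}
    (hE : IsSpecialization L M (pointIncl k L t) E) : Module.finrank (RatFunc k) F ≤ 1 := by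
  obtain ⟨𝔓, hprime, hover, ⟨e⟩⟩ := hE
  have h𝔓 := (Ideal.mem_of_liesOver 𝔓 (lineIdeal L _) _).mp
    (Ideal.mem_span_singleton_self (lineParam L (pointIncl k L t)))
  have : IsScalarTower (lineRing k t) (integralClosure (lineRing k t) F) F :=
    IsScalarTower.of_algebraMap_eq fun _ => rfl
  have : IsScalarTower (lineRing L (pointIncl k L t))
      (integralClosure (lineRing L (pointIncl k L t)) M) M :=
    IsScalarTower.of_algebraMap_eq fun _ => rfl
  exact finrank_le_one_of_constant_point hF hφ hM (t := t) (integralClosure (lineRing k t) F)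
    (integralClosure (lineRing L (pointIncl k L t)) M) 𝔓 h𝔓 hk e hdeg

include hF in
/-- If `k` is algebraically closed in `E`, then a point of `ℙ¹(L)` at which `FL/L(T)` specializes
to `E/L` is transcendental over `k`, unless `F = k(T)`; and `E` is the splitting field of `P` at
this point. -/
theorem exists_transcendental_of_isSpecialization [CharZero k] [CharZero L] (hP : P.Monic)
    (hsep : (polyOverRatFunc k P).Separable) [Algebra k E] [IsScalarTower k L E]
    [FiniteDimensional L E] [IsGalois L E]
    (hk : ∀ x : E, IsAlgebraic k x → x ∈ (algebraMap k E).range)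
    (hdeg : Module.finrank (RatFunc k) F ≤ Module.finrank L E) {t : OnePoint L}
    (hE : IsSpecialization L (compositum k F L) t E) :
    Module.finrank (RatFunc k) F ≤ 1 ∨
      ∃ t₀ : L, Transcendental k t₀ ∧ (specializePoly k P t₀).IsSplittingField L E := by
  have hM := compositum_isSplittingField L hF
  by_cases hconst : ∃ s : OnePoint k, pointIncl k L s = t
  · obtain ⟨s, rfl⟩ := hconst
    obtain ⟨φ, hφ⟩ := exists_embedding_compositum L hF
    exact .inl (finrank_le_one_of_isSpecialization_pointIncl hM hF hφ hk hdeg hE)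
  · rcases t with _ | t
    · exact absurd ⟨none, rfl⟩ hconst
    · have htr : Transcendental k t := fun halg => by
        obtain ⟨c, hc⟩ := hk _ (halg.algebraMap (A := E))
        refine hconst ⟨some c, congrArg some ((algebraMap L E).injective ?_)⟩
        rwa [← IsScalarTower.algebraMap_apply]
      exact .inr ⟨t, htr, isSplittingField_of_isSpecialization hM hP hsep htr hE⟩

end SpecializedExtensions

/-! ### Generic polynomials and generic extensions -/

section GroupTransport

variable {G : Type w} [Group G] {H : Type*} [Group H]

theorem IsGaloisOfGroup.congr (e : G ≃* H) {L : Type u} {E : Type v} [Field L] [Field E]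
    [Algebra L E] (h : IsGaloisOfGroup G L E) : IsGaloisOfGroup H L E :=
  ⟨h.1, h.2.1, h.2.2.map fun f => f.trans e⟩

theorem IsGaloisOfGroup.finrank_eq {L : Type u} {E : Type v} [Field L] [Field E]
    [Algebra L E] (h : IsGaloisOfGroup G L E) : Module.finrank L E = Nat.card G := by
  obtain ⟨_, _, ⟨e⟩⟩ := h
  rw [← IsGalois.card_aut_eq_finrank, Nat.card_congr e.toEquiv]

end GroupTransport

section Generic

open Polynomial

attribute [local instance] noetherAction

variable {k : Type u} [Field k]

/-- The Noether extension `k(x_h : h ∈ H)` of the field of invariants is the splitting field of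
`P(t₀,Y)` for some invariant `t₀` which is transcendental over `k`. -/
def ParametrizesNoether (H : Type) [Group H] (P : k[X][X]) : Prop :=
  ∃ t₀ : NoetherFixed k H, Transcendental k t₀ ∧
    (specializePoly k P t₀).IsSplittingField (NoetherFixed k H) (NoetherField k H)

variable {P : k[X][X]} {H : Type} [Group H] {F : Type v} [Field F] [Algebra (RatFunc k) F]

theorem exists_eq_algebraMap_of_isAlgebraic {t : NoetherFixed k H} (ht : IsAlgebraic k t) :
    ∃ c : k, algebraMap k (NoetherFixed k H) c = t := by
  obtain ⟨c, hc⟩ := mem_range_of_isAlgebraic_noetherField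
    (ht.algebraMap (A := NoetherField k H))
  exact ⟨c, Subtype.ext hc⟩

/-- If `F = k(T)` and the group is trivial, then any indeterminate is a suitable parameter. -/
theorem ParametrizesNoether.of_finrank_le_one [Finite H]
    (hF : (polyOverRatFunc k P).IsSplittingField (RatFunc k) F)
    (hcard : Module.finrank (RatFunc k) F = Nat.card H)
    (hle : Module.finrank (RatFunc k) F ≤ 1) : ParametrizesNoether H P := by
  have hH : Subsingleton H := Finite.card_le_one_iff_subsingleton.mp (hcard ▸ hle)
  have hF1 : Module.finrank (RatFunc k) F = 1 := le_antisymm hle (hcard ▸ Nat.card_pos)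
  let x : NoetherField k H := algebraMap (MvPolynomial H k) _ (MvPolynomial.X 1)
  let t₀ : NoetherFixed k H := ⟨x, fun h => by rw [Subsingleton.elim h 1, one_smul]⟩
  have ht₀ : Transcendental k t₀ :=
    (transcendental_algebraMap_iff (A := NoetherField k H) Subtype.val_injective).mp
      (transcendental_noetherField_X (k := k) (1 : H))
  refine ⟨t₀, ht₀, ?_⟩
  have hgal := noether_isGaloisOfGroup k H
  have hdim := hgal.finrank_eq
  obtain ⟨_, _, ⟨e⟩⟩ := hgal
  have hsplit : (polyOverRatFunc k P).Splits := by
    have hbij : Function.Bijective (algebraMap (RatFunc k) F) :=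
      ⟨(algebraMap (RatFunc k) F).injective, fun x => by
        obtain ⟨c, hc⟩ := (finrank_eq_one_iff_of_nonzero' (1 : F) one_ne_zero).mp hF1 x
        exact ⟨c, by rw [← hc, Algebra.algebraMap_eq_smul_one]⟩⟩
    have h1 := hF.splits'.map (RingEquiv.ofBijective _ hbij).symm.toRingHom
    rwa [Polynomial.map_map, show (RingEquiv.ofBijective _ hbij).symm.toRingHom.comp
      (algebraMap (RatFunc k) F) = RingHom.id _ from RingHom.ext fun z =>
        (RingEquiv.ofBijective _ hbij).symm_apply_apply z, Polynomial.map_id] at h1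
  obtain ⟨θ, hθ⟩ := exists_ratFunc_algHom ht₀
  refine isSplittingField_of_forall_fix_eq_one ?_ fun σ _ => ?_
  · have h1 := (hsplit.map θ.toRingHom).map (algebraMap _ (NoetherField k H))
    rwa [polyOverRatFunc_eq, specializeAt_map, hθ] at h1
  · exact e.injective (Subsingleton.elim _ _)

/-- If the Noether extension is obtained from `P`, then `F` embeds into a field of rational
functions, and is therefore regular. -/
theorem ParametrizesNoether.algebraicClosure_eq_bot [Algebra k F] [IsScalarTower k (RatFunc k) F]
    (h : ParametrizesNoether H P) (hF : (polyOverRatFunc k P).IsSplittingField (RatFunc k) F) :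
    algebraicClosure k F = ⊥ := by
  obtain ⟨t₀, ht₀, hsplit⟩ := h
  obtain ⟨θ, hθ⟩ := exists_ratFunc_algHom ht₀
  let θ' : RatFunc k →ₐ[k] NoetherField k H := (NoetherFixed k H).val.comp θ
  let : Algebra (RatFunc k) (NoetherField k H) := θ'.toRingHom.toAlgebra
  have : IsScalarTower k (RatFunc k) (NoetherField k H) :=
    IsScalarTower.of_algebraMap_eq fun c => (θ'.commutes c).symm
  have hs : ((polyOverRatFunc k P).map (algebraMap (RatFunc k) (NoetherField k H))).Splits := by
    have h1 := hsplit.splits'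
    rw [specializePoly_eq, ← hθ, ← specializeAt_map, ← polyOverRatFunc_eq, Polynomial.map_map] at h1
    exact h1
  let ψ : F →ₐ[k] NoetherField k H :=
    (IsSplittingField.lift F (polyOverRatFunc k P) hs).restrictScalars k
  refine eq_bot_iff.mpr fun x hx => ?_
  obtain ⟨c, hc⟩ := mem_range_of_isAlgebraic_noetherField
    ((mem_algebraicClosure_iff.mp hx).algHom ψ)
  refine IntermediateField.mem_bot.mpr ⟨c, ψ.toRingHom.injective ?_⟩
  exact (ψ.commutes c).trans hc

/-- A specialization of `P` at a constant does not yield a nontrivial Noether extension, as its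
roots would be algebraic over `k`. -/
theorem finrank_le_one_of_isSplittingField_of_isAlgebraic (hP : P.Monic) {t : NoetherFixed k H}
    (ht : IsAlgebraic k t)
    (hs : (specializePoly k P t).IsSplittingField (NoetherFixed k H) (NoetherField k H)) :
    Module.finrank (NoetherFixed k H) (NoetherField k H) ≤ 1 := by
  obtain ⟨c, rfl⟩ := exists_eq_algebraMap_of_isAlgebraic ht
  have hbot : (⊥ : Subalgebra (NoetherFixed k H) (NoetherField k H)) = ⊤ := by
    refine top_unique (hs.adjoin_rootSet' ▸ Algebra.adjoin_le fun y hy => ?_)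
    have halg : IsAlgebraic k y := by
      refine ⟨specializeAt P c, (specializeAt_monic hP c).ne_zero, ?_⟩
      have h1 := (mem_rootSet'.mp hy).2
      rw [specializePoly_eq, ← specializeAt_map_algebraMap, aeval_map_algebraMap] at h1
      exact h1
    obtain ⟨a, rfl⟩ := mem_range_of_isAlgebraic_noetherField halg
    exact ⟨algebraMap k _ a, rfl⟩
  exact (Subalgebra.bot_eq_top_iff_finrank_eq_one.mp hbot).le

variable [Finite H] {G : Type w} [Group G]

theorem ParametrizesNoether.of_isGenericPolynomial (e : H ≃* G) (h : IsGenericPolynomial k G P)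
    (hF : (polyOverRatFunc k P).IsSplittingField (RatFunc k) F)
    (hcard : Module.finrank (RatFunc k) F = Nat.card H) : ParametrizesNoether H P := by
  have hN := noether_isGaloisOfGroup k H
  obtain ⟨t, ht⟩ := h.parametrizes (NoetherFixed k H) (NoetherField k H) (hN.congr e)
  by_cases htr : Transcendental k t
  · exact ⟨t, htr, ht⟩
  · refine .of_finrank_le_one hF hcard ?_
    rw [hcard, ← hN.finrank_eq]
    exact finrank_le_one_of_isSplittingField_of_isAlgebraic h.monic (not_not.mp htr) ht

theorem ParametrizesNoether.of_isParametric [CharZero k] (e : H ≃* G) (hP : P.Monic)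
    (hsep : (polyOverRatFunc k P).Separable)
    (hF : (polyOverRatFunc k P).IsSplittingField (RatFunc k) F) [Algebra k F]
    [IsScalarTower k (RatFunc k) F]
    (hcard : Module.finrank (RatFunc k) F = Nat.card H)
    (h : IsParametric k G F (NoetherFixed k H)) : ParametrizesNoether H P := by
  have hN := noether_isGaloisOfGroup k H
  obtain ⟨t, ht⟩ := h (NoetherField k H) (hN.congr e)
  have hdeg := (hcard.trans hN.finrank_eq.symm).le
  have : CharZero (NoetherFixed k H) :=
    charZero_of_injective_algebraMap (algebraMap k _).injective
  obtain ⟨_, _, -⟩ := hN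
  exact (exists_transcendental_of_isSpecialization hF hP hsep
    (fun x hx => mem_range_of_isAlgebraic_noetherField hx) hdeg ht).elim
    (.of_finrank_le_one hF hcard) id

end Generic

/-- Over a field `k` of characteristic zero, a monic separable polynomial `P(T,Y)` of group `G` and
splitting field `F` over `k(T)` is generic if and only if the extension `F/k(T)` is generic. -/
theorem mainTheorem10 (k : Type u) [Field k] [CharZero k]
    (G : Type w) [Group G] [Finite G]
    (P : k[X][X]) (hmonic : P.Monic) (hsep : (polyOverRatFunc k P).Separable)
    (F : Type v) [Field F] [Algebra (RatFunc k) F] [Algebra k F] [IsScalarTower k (RatFunc k) F]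
    (hF : (polyOverRatFunc k P).IsSplittingField (RatFunc k) F)
    (hG : Nonempty ((F ≃ₐ[RatFunc k] F) ≃* G)) :
    IsGenericPolynomial k G P ↔ IsGenericExtension k G F := by
  have hgal : IsGalois (RatFunc k) F := IsGalois.of_separable_splitting_field hsep
  have hFG : IsGaloisOfGroup G (RatFunc k) F := ⟨hF.finiteDimensional, hgal, hG⟩
  let H : Type := Shrink.{0} G
  let e : H ≃* G := Shrink.mulEquiv
  have : Finite H := Finite.of_equiv G e.symm.toEquiv
  have hcard : Module.finrank (RatFunc k) F = Nat.card H := by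
    rw [hFG.finrank_eq, Nat.card_congr e.toEquiv]
  constructor
  · intro h
    refine ⟨⟨hFG, ?_⟩, fun L _ _ E _ _ hE => ?_⟩
    · exact (ParametrizesNoether.of_isGenericPolynomial e h hF hcard).algebraicClosure_eq_bot hF
    · have : CharZero L := charZero_of_injective_algebraMap (algebraMap k L).injective
      obtain ⟨t₀, ht₀⟩ := h.parametrizes L E hE
      refine ⟨t₀, isSpecialization_of_isSplittingField (compositum_isSplittingField L hF) hmonic
        ht₀ ?_⟩
      obtain ⟨φ, hφ⟩ := exists_embedding_compositum L hF
      rw [hE.finrank_eq, ← hFG.finrank_eq]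
      exact finrank_le_of_isSplittingField hF hφ (compositum_isSplittingField L hF)
  · intro h
    obtain ⟨t₀, ht₀, hsplit⟩ := ParametrizesNoether.of_isParametric e hmonic hsep hF hcard (h.2 _)
    refine ⟨hmonic, hsep, ?_, fun L _ _ E _ _ hE => ?_⟩
    · obtain ⟨g⟩ := hG
      let ε : F ≃ₐ[RatFunc k] (polyOverRatFunc k P).SplittingField :=
        Polynomial.IsSplittingField.algEquiv F (polyOverRatFunc k P)
      exact ⟨(AlgEquiv.autCongr ε).symm.trans g⟩
    · exact exists_isSplittingField_of_noether hmonic t₀ (separable_specializePoly hsep ht₀) hsplit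
        L E (hE.congr e.symm)

end
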